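/- Let $M$ be the closed orientable Seifert fibered space with Seifert index $\{b,(o,g);(\alpha_1,\beta_1),\dots,(\alpha_m,\beta_m)\}$, where $b\in\mathbb Z$, $g,m\ge 0$, $\alpha_j\ge 2$ and $\gcd(\alpha_j,\beta_j)=1$. That is, $M$ is obtained from $\Sigma_*\times S^1$, where $\Sigma_*$ is the compact orientable surface of genus $g$ with boundary circles $q_0,\dots,q_m$, by gluing in solid tori $S_0,\dots,S_m$ whose meridians are $q_0-b\,h$ and $\alpha_jq_j+\beta_jh$ ($1\le j\le m$), where $h$ is the regular fiber; here the generators $a_i,b_i,q_1,\dots,q_m$ of $\pi_1(\Sigma_*)$ are chosen so that $q_0=q_1\cdots q_m[a_1,b_1]\cdots[a_g,b_g]$. Let $\ell_j\in\pi_1(M)$ be the homotopy class (defined up to conjugation) of the core of $S_j$. Let $\rho:\pi_1(M)\to \mathrm{SL}_2(\mathbb C)$ be a homomorphism with $\rho(h)=-I$. For $n\ge1$ let $\rho_n=\sigma_n\circ\rho$, where $\sigma_n$ is the $n$-dimensional representation of $\mathrm{SL}_2(\mathbb C)$ on the space $V_n$ of homogeneous polynomials of degree $n-1$ in two variables, $(A\cdot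 p)(z)=p(A^{-1}z)$. Let $\mathrm{Tor}(M;\rho_n)\in\mathbb C^{*}$ denote the Reidemeister torsion, determined up to sign, of the twisted cellular chain complex $V_n\otimes_{\mathbb Z[\pi_1(M)]}C_*(\widetilde M;\mathbb Z)$ (with $v\otimes\gamma c=\rho_n(\gamma)^{-1}v\otimes c$) when this complex is acyclic, with the convention $$\mathrm{Tor}(C_*,\mathbf c)=\prod_{i\ge0}\bigl[\partial_{i+1}(\tilde{\mathbf b}^{i+1})\cup\tilde{\mathbf b}^i/\mathbf c^i\bigr]^{(-1)^{i+1}}.$$ Then $\rho_{2N}$ is acyclic for every $N\ge1$; for $1\le j\le m$ the order of $\rho(\ell_j)$ is finite and even, say $2\lambda_j$; and $$\lim_{N\to\infty}\frac{\log|\mathrm{Tor}(M;\rho_{2N})|}{(2N)^2}=0,\qquad \lim_{N\to\infty}\frac{\log|\mathrm{Tor}(M;\rho_{2N})|}{2N}=-\Bigl(2-2g-\sum_{j=1}^m\frac{\lambda_j-1}{\lambda_j}\Bigr)\log 2 .$$ In particular, if $\lambda_j=\alpha_j$ for all $j$, then $$\lim_{N\to\infty}\frac{\log|\mathrm{Tor}(M;\rho_{2N})|}{2N}=-\Bigl(2-2g-\sum_{j=1}^m\frac{\alpha_j-1}{\alpha_j}\Bigr)\log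 2=-\chi\log2,$$ where $\chi=2-2g-\sum_{j=1}^m\bigl(1-\tfrac1{\alpha_j}\bigr)$ is the Euler characteristic of the base orbifold. -/

import Mathlib

open scoped unitInterval MatrixGroups

namespace SeifertTorsion

noncomputable section

/-! ### Torsion of based acyclic chain complexes -/

section Torsion

variable {F : Type*} [Field F] (C : ℕ → Type*) [∀ i, AddCommGroup (C i)] [∀ i, Module F (C i)]

/-- The chain complex `⋯ → C 2 → C 1 → C 0 → 0`, whose boundary operator
`C (i + 1) → C i` is `d i`, has trivial homology in every degree. -/
def IsAcyclic (d : ∀ i, C (i + 1) →ₗ[F] C i) : Prop :=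
  LinearMap.range (d 0) = ⊤ ∧ ∀ i, LinearMap.ker (d i) = LinearMap.range (d (i + 1))

/-- `τ` is a value of the torsion of the acyclic complex `0 → C n → ⋯ → C 0 → 0` based by `c`.
For every `i` one chooses vectors `b i` in `C i` that the boundary operator maps to a basis of the
space of boundaries in degree `i - 1` (none for `i = 0`).  Then the boundaries of `b (i + 1)`
together with `b i` are a new basis of `C i`, and
`τ = ∏ i, [∂ b (i + 1) ∪ b i / c i] ^ ((-1) ^ (i + 1))`.
The bijections `e i` only fix the order of the vectors of the new basis relative to that of `c i`,
so `τ` is determined up to sign. -/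
def IsTorsion (d : ∀ i, C (i + 1) →ₗ[F] C i) {ι : ℕ → Type*} [∀ i, Fintype (ι i)]
    [∀ i, DecidableEq (ι i)] (c : ∀ i, Module.Basis (ι i) F (C i)) (n : ℕ) (τ : F) : Prop :=
  IsAcyclic C d ∧
  ∃ (r : ℕ → ℕ) (b : ∀ i, Fin (r i) → C i) (e : ∀ i, ι i ≃ Fin (r (i + 1)) ⊕ Fin (r i)),
    r 0 = 0 ∧
    (∀ i, LinearIndependent F (fun k => d i (b (i + 1) k)) ∧
      Submodule.span F (Set.range fun k => d i (b (i + 1) k)) = LinearMap.range (d i)) ∧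
    τ = ∏ i ∈ Finset.range (n + 1),
      (c i).det (fun x => Sum.elim (fun k => d i (b (i + 1) k)) (b i) (e i x)) ^ ((-1 : ℤ) ^ (i + 1))

end Torsion

/-! ### Cellular chain complexes of universal covers, and their twisted versions -/

/-- The cellular chain complex of the universal cover of a finite connected CW complex with
fundamental group `G`: the chain module in degree `i` is the free left `ℤ[G]`-module on the
`i`-cells (one lift being chosen for each cell), and
`∂ (lift of c) = ∑ c', bdry i c c' • (lift of c')`. -/
structure CoverComplex (G : Type) [Group G] where
  dim : ℕ
  cell : ℕ → Type
  fintypeCell : ∀ i, Fintype (cell i)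
  decEqCell : ∀ i, DecidableEq (cell i)
  isEmpty_cell : ∀ i, dim < i → IsEmpty (cell i)
  bdry : ∀ i, cell (i + 1) → cell i → MonoidAlgebra ℤ G

attribute [instance] CoverComplex.fintypeCell CoverComplex.decEqCell

section Twisted

variable {G : Type} [Group G] {V : Type} [AddCommGroup V] [Module ℂ V]

/-- The right action of `ℤ[G]` on `V` in which `γ : G` acts by `ρ(γ)⁻¹`. -/
def rightAction (ρ : Representation ℂ G V) (a : MonoidAlgebra ℤ G) : V →ₗ[ℂ] V :=
  a.coeff.sum fun γ k => k • ρ γ⁻¹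

/-- The chain module `V ⊗_{ℤ[G]} C_i`; the function `f` stands for `∑ c, f c ⊗ c`. -/
abbrev CoverComplex.TwistedChain (K : CoverComplex G) (V : Type) (i : ℕ) : Type :=
  K.cell i → V

/-- The boundary operator of `V ⊗_{ℤ[G]} C_*`, where `v ⊗ γ c = ρ(γ)⁻¹ v ⊗ c`. -/
def CoverComplex.twistedBoundary (K : CoverComplex G) (ρ : Representation ℂ G V) (i : ℕ) :
    K.TwistedChain V (i + 1) →ₗ[ℂ] K.TwistedChain V i :=
  LinearMap.pi fun c' => ∑ c, rightAction ρ (K.bdry i c c') ∘ₗ LinearMap.proj c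

/-- The representation `ρ` is acyclic: the twisted homology vanishes. -/
def CoverComplex.IsAcyclicRep (K : CoverComplex G) (ρ : Representation ℂ G V) : Prop :=
  IsAcyclic (K.TwistedChain V) (K.twistedBoundary ρ)

/-- `τ` is a value of the Reidemeister torsion for the acyclic representation `ρ`: the torsion of
the twisted chain complex based by the vectors `B k ⊗ c`, with `B` a basis of `V`. -/
def CoverComplex.IsReidemeisterTorsion (K : CoverComplex G) (ρ : Representation ℂ G V) (τ : ℂ) :
    Prop :=
  ∃ B : Module.Basis (Fin (Module.finrank ℂ V)) ℂ V,
    IsTorsion (K.TwistedChain V) (K.twistedBoundary ρ)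
      (fun i => Pi.basis fun _ : K.cell i => B) K.dim τ

end Twisted

/-! ### The irreducible representations of `SL(2, ℂ)` -/

/-- Homogeneous polynomials of degree `n - 1` in two variables (for `n ≥ 1`). -/
abbrev BinaryForms (n : ℕ) : Type := MvPolynomial.homogeneousSubmodule (Fin 2) ℂ (n - 1)

/-- The substitution `p(z) ↦ p(A z)`. -/
def substitute (A : Matrix (Fin 2) (Fin 2) ℂ) :
    MvPolynomial (Fin 2) ℂ →ₐ[ℂ] MvPolynomial (Fin 2) ℂ :=
  MvPolynomial.aeval fun i => ∑ k, MvPolynomial.C (A i k) * MvPolynomial.X k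

theorem substitute_X (A : Matrix (Fin 2) (Fin 2) ℂ) (i : Fin 2) :
    substitute A (MvPolynomial.X i) = ∑ k, MvPolynomial.C (A i k) * MvPolynomial.X k :=
  MvPolynomial.aeval_X _ i

theorem substitute_C (A : Matrix (Fin 2) (Fin 2) ℂ) (a : ℂ) :
    substitute A (MvPolynomial.C a) = MvPolynomial.C a :=
  MvPolynomial.aeval_C _ a

theorem substitute_mul (A B : Matrix (Fin 2) (Fin 2) ℂ) (p : MvPolynomial (Fin 2) ℂ) :
    substitute (A * B) p = substitute B (substitute A p) := by
  have h : substitute (A * B) = (substitute B).comp (substitute A) := by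
    refine MvPolynomial.algHom_ext fun i => ?_
    simp only [AlgHom.comp_apply, substitute_X, substitute_C, Matrix.mul_apply, Fin.sum_univ_two,
      map_add, map_mul]
    ring
  rw [h, AlgHom.comp_apply]

theorem substitute_one (p : MvPolynomial (Fin 2) ℂ) : substitute 1 p = p := by
  have h : substitute 1 = AlgHom.id ℂ _ := by
    refine MvPolynomial.algHom_ext fun i => ?_
    fin_cases i <;> simp [substitute_X, Fin.sum_univ_two]
  rw [h, AlgHom.id_apply]

theorem substitute_mem (A : Matrix (Fin 2) (Fin 2) ℂ) (k : ℕ) (p : MvPolynomial (Fin 2) ℂ)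
    (hp : p ∈ MvPolynomial.homogeneousSubmodule (Fin 2) ℂ k) :
    substitute A p ∈ MvPolynomial.homogeneousSubmodule (Fin 2) ℂ k := by
  have h : (substitute A p).IsHomogeneous (1 * k) := by
    refine MvPolynomial.IsHomogeneous.aeval
      ((MvPolynomial.mem_homogeneousSubmodule k p).1 hp) _ fun i => ?_
    refine MvPolynomial.IsHomogeneous.sum _ _ _ fun l _ => ?_
    exact MvPolynomial.isHomogeneous_C_mul_X (A i l) l
  rw [one_mul] at h
  exact (MvPolynomial.mem_homogeneousSubmodule k _).2 h

/-- The action of `A` on homogeneous polynomials: `(A · p)(z) = p(A⁻¹ z)`. -/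
def symAct (n : ℕ) (A : SL(2, ℂ)) : BinaryForms n →ₗ[ℂ] BinaryForms n where
  toFun p := ⟨substitute (A⁻¹).1 p.1, substitute_mem (A⁻¹).1 (n - 1) p.1 p.2⟩
  map_add' p q := Subtype.ext (map_add (substitute (A⁻¹).1) p.1 q.1)
  map_smul' a p := Subtype.ext (map_smul (substitute (A⁻¹).1) a p.1)

theorem symAct_one (n : ℕ) : symAct n 1 = 1 := by
  refine LinearMap.ext fun p => Subtype.ext ?_
  have h : ((1 : SL(2, ℂ))⁻¹).1 = 1 := by rw [inv_one]; rfl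
  exact (congrArg (fun M => substitute M p.1) h).trans (substitute_one p.1)

theorem symAct_mul (n : ℕ) (A B : SL(2, ℂ)) : symAct n (A * B) = symAct n A * symAct n B := by
  refine LinearMap.ext fun p => Subtype.ext ?_
  have h : ((A * B)⁻¹).1 = (B⁻¹).1 * (A⁻¹).1 := by rw [mul_inv_rev]; rfl
  exact (congrArg (fun M => substitute M p.1) h).trans (substitute_mul _ _ p.1)

/-- The representation `σ_n` of `SL(2, ℂ)`, of dimension `n` (for `n ≥ 1`). -/
def symRep (n : ℕ) : Representation ℂ SL(2, ℂ) (BinaryForms n) where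
  toFun := symAct n
  map_one' := symAct_one n
  map_mul' := symAct_mul n

/-! ### Fundamental groups -/

/-- The fundamental group of `X` at `x`, in which the product `p * q` is "first `p`, then `q`"
(in Mathlib's `FundamentalGroup` it is "first `q`, then `p`"). -/
abbrev PiOne (X : Type) [TopologicalSpace X] (x : X) : Type := (FundamentalGroup X x)ᵐᵒᵖ

/-- The class of a loop in the fundamental group. -/
def loopClass {X : Type} [TopologicalSpace X] {x : X} (γ : Path x x) : PiOne X x :=
  MulOpposite.op (FundamentalGroup.fromPath (Path.Homotopic.Quotient.mk γ))

/-- The loop running once around the unit circle. -/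
def circleLoop : Path (1 : Circle) 1 where
  toFun s := Circle.exp (2 * Real.pi * s)
  source' := by simp
  target' := by simp

/-! ### Wedges of circles -/

/-- The wedge of circles indexed by `E`, as the union of the coordinate circles of a torus. -/
abbrev Wedge (E : Type) : Type := {f : E → Circle // ∀ e e', f e ≠ 1 → f e' ≠ 1 → e = e'}

/-- The common point of the circles. -/
def Wedge.base (E : Type) : Wedge E := ⟨1, fun _ _ h => absurd rfl h⟩

section Words

variable {E : Type} [DecidableEq E]

/-- The inclusion of the circle with index `e`. -/
def Wedge.petal (e : E) (z : Circle) : Wedge E :=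
  ⟨Pi.mulSingle e z, fun e₁ e₂ h₁ h₂ => by
    have key : ∀ e', (Pi.mulSingle e z : E → Circle) e' ≠ 1 → e' = e := fun e' h => by
      by_contra hne
      exact h (Pi.mulSingle_eq_of_ne (M := fun _ => Circle) hne z)
    rw [key e₁ h₁, key e₂ h₂]⟩

theorem Wedge.continuous_petal (e : E) : Continuous (Wedge.petal e) :=
  Continuous.subtype_mk (continuous_mulSingle (A := fun _ : E => Circle) e) _

theorem Wedge.petal_one (e : E) : Wedge.petal e 1 = Wedge.base E :=
  Subtype.ext (Pi.mulSingle_one e)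

/-- The loop running once around the circle with index `e`. -/
def Wedge.petalLoop (e : E) : Path (Wedge.base E) (Wedge.base E) :=
  (circleLoop.map (Wedge.continuous_petal e)).cast (Wedge.petal_one e).symm
    (Wedge.petal_one e).symm

/-- The loop spelled by a word; `(e, true)` stands for the letter `e` and `(e, false)` for its
inverse. -/
def Wedge.wordLoop : List (E × Bool) → Path (Wedge.base E) (Wedge.base E)
  | [] => Path.refl _
  | (e, true) :: w => (Wedge.petalLoop e).trans (Wedge.wordLoop w)
  | (e, false) :: w => (Wedge.petalLoop e).symm.trans (Wedge.wordLoop w)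

end Words

/-! ### Seifert fibered spaces -/

/-- The Seifert index `{b, (o, g); (α 0, β 0), …, (α (m - 1), β (m - 1))}`. -/
structure SeifertIndex where
  b : ℤ
  g : ℕ
  m : ℕ
  α : Fin m → ℕ
  β : Fin m → ℤ
  two_le : ∀ j, 2 ≤ α j
  coprime : ∀ j, IsCoprime (α j : ℤ) (β j)

/-- Integers `μ j`, `ν j` with `α j * ν j - β j * μ j = -1`.  The gluing of the `j`-th solid torus
`D² × S¹` takes the meridian `∂D² × {*}` to `α q + β h` and the longitude `{*} × S¹` to
`μ q + ν h`. -/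
structure SeifertIndex.Framing (S : SeifertIndex) where
  μ : Fin S.m → ℤ
  ν : Fin S.m → ℤ
  det : ∀ j, (S.α j : ℤ) * ν j - S.β j * μ j = -1

/-- The Euler characteristic of the base orbifold, which is the closed orientable surface of
genus `g` with cone points of orders `α j`. -/
def SeifertIndex.orbifoldEulerChar (S : SeifertIndex) : ℝ :=
  2 - 2 * (S.g : ℝ) - ∑ j, (1 - 1 / (S.α j : ℝ))

/-- The slopes of all `m + 1` solid tori; the one with index `0` has slope `1 / (-b)` and accounts
for the obstruction class `b`. -/
def SeifertIndex.slopeα (S : SeifertIndex) : Fin (S.m + 1) → ℤ := Fin.cons 1 fun j => (S.α j : ℤ)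

def SeifertIndex.slopeβ (S : SeifertIndex) : Fin (S.m + 1) → ℤ := Fin.cons (-S.b) S.β

def SeifertIndex.Framing.slopeμ {S : SeifertIndex} (T : S.Framing) : Fin (S.m + 1) → ℤ :=
  Fin.cons 0 T.μ

def SeifertIndex.Framing.slopeν {S : SeifertIndex} (T : S.Framing) : Fin (S.m + 1) → ℤ :=
  Fin.cons (-1) T.ν

/-- The free generators `a i`, `b i` (`i < g`) and `q j` (`j < m`) of the fundamental group of the
surface of genus `g` with `m + 1` boundary circles. -/
abbrev Gen (g m : ℕ) : Type := (Fin g ⊕ Fin g) ⊕ Fin m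

abbrev Gen.a {g m : ℕ} (i : Fin g) : Gen g m := Sum.inl (Sum.inl i)
abbrev Gen.b {g m : ℕ} (i : Fin g) : Gen g m := Sum.inl (Sum.inr i)
abbrev Gen.q {g m : ℕ} (j : Fin m) : Gen g m := Sum.inr j

/-- The words spelled by the `m + 1` boundary circles: the one with index `0` is
`q 1 ⋯ q m [a 1, b 1] ⋯ [a g, b g]`, and the others are the letters `q j`. -/
def boundaryWord (g m : ℕ) : Fin (m + 1) → List (Gen g m × Bool) :=
  Fin.cons
    ((List.finRange m).map (fun j => (Gen.q j, true)) ++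
      (List.finRange g).flatMap fun i =>
        [(Gen.a i, true), (Gen.b i, true), (Gen.a i, false), (Gen.b i, false)])
    (fun j => [(Gen.q j, true)])

/-- The gluing that defines the surface: the end `u = 0` of the annulus `S¹ × [0, 1]` with index
`j` is attached to the wedge of circles along the `j`-th boundary word. -/
inductive SurfaceRel (g m : ℕ) :
    Wedge (Gen g m) ⊕ (Fin (m + 1) × Circle × I) →
      Wedge (Gen g m) ⊕ (Fin (m + 1) × Circle × I) → Prop
  | glue (j : Fin (m + 1)) (s : I) :
      SurfaceRel g m (Sum.inr (j, circleLoop s, 0))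
        (Sum.inl (Wedge.wordLoop (boundaryWord g m j) s))

/-- The compact orientable surface `Σ_*` of genus `g` with `m + 1` boundary circles, as a ribbon
surface: a wedge of `2 g + m` circles thickened by one annulus for each boundary circle.  (The
boundary words run over every circle of the wedge exactly twice, and capping off the annuli by discs
gives the closed orientable surface of genus `g`.) -/
def Surface (g m : ℕ) : Type := Quot (SurfaceRel g m)

instance (g m : ℕ) : TopologicalSpace (Surface g m) :=
  inferInstanceAs (TopologicalSpace (Quot (SurfaceRel g m)))

/-- The inclusion of the wedge of circles into the surface. -/
def Surface.ofWedge {g m : ℕ} (x : Wedge (Gen g m)) : Surface g m := Quot.mk _ (Sum.inl x)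

/-- The annuli in the surface. -/
def Surface.annulus {g m : ℕ} (j : Fin (m + 1)) (x : Circle) (u : I) : Surface g m :=
  Quot.mk _ (Sum.inr (j, x, u))

theorem Surface.continuous_ofWedge {g m : ℕ} :
    Continuous (Surface.ofWedge : Wedge (Gen g m) → Surface g m) :=
  continuous_quot_mk.comp continuous_inl

theorem Surface.continuous_annulus {g m : ℕ} (j : Fin (m + 1)) :
    Continuous (fun p : Circle × I => (Surface.annulus j p.1 p.2 : Surface g m)) :=
  continuous_quot_mk.comp (continuous_inr.comp (by fun_prop))

theorem Surface.annulus_one_zero {g m : ℕ} (j : Fin (m + 1)) :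
    (Surface.annulus j 1 0 : Surface g m) = Surface.ofWedge (Wedge.base _) := by
  have h := Quot.sound (SurfaceRel.glue (g := g) (m := m) j 0)
  rw [Path.source, Path.source] at h
  exact h

/-- The closed unit disc. -/
abbrev Disc : Type := Metric.closedBall (0 : ℂ) 1

/-- The boundary circle of the disc. -/
def Disc.ofCircle (x : Circle) : Disc := ⟨x, by simp [Circle.norm_coe]⟩

/-- The radial path from the boundary point `1` to the centre of the disc. -/
def Disc.ray (r : I) : Disc :=
  ⟨((1 - r : ℝ) : ℂ), by
    rw [mem_closedBall_zero_iff, Complex.norm_real, Real.norm_eq_abs, abs_le]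
    constructor <;> linarith [r.2.1, r.2.2]⟩

/-- The Dehn filling: on the boundary of the `j`-th solid torus `D² × S¹`, the point `(x, y)` is
glued to the point with coordinates `(x ^ α * y ^ μ, x ^ β * y ^ ν)` on the `j`-th boundary torus
(boundary circle `q j` times fiber `h`) of `Σ_* × S¹`. -/
inductive SpaceRel (S : SeifertIndex) (T : S.Framing) :
    (Surface S.g S.m × Circle) ⊕ (Fin (S.m + 1) × Disc × Circle) →
      (Surface S.g S.m × Circle) ⊕ (Fin (S.m + 1) × Disc × Circle) → Prop
  | glue (j : Fin (S.m + 1)) (x y : Circle) :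
      SpaceRel S T (Sum.inr (j, Disc.ofCircle x, y))
        (Sum.inl (Surface.annulus j (x ^ S.slopeα j * y ^ T.slopeμ j) 1,
          x ^ S.slopeβ j * y ^ T.slopeν j))

/-- The Seifert fibered space with index `S`: the trivial circle bundle `Σ_* × S¹` with `m + 1`
solid tori glued in. -/
def Space (S : SeifertIndex) (T : S.Framing) : Type := Quot (SpaceRel S T)

instance (S : SeifertIndex) (T : S.Framing) : TopologicalSpace (Space S T) :=
  inferInstanceAs (TopologicalSpace (Quot (SpaceRel S T)))

section Loops

variable (S : SeifertIndex) (T : S.Framing)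

/-- The inclusion of the circle bundle. -/
def Space.ofBundle (p : Surface S.g S.m × Circle) : Space S T := Quot.mk _ (Sum.inl p)

/-- The inclusions of the solid tori. -/
def Space.ofSolidTorus (j : Fin (S.m + 1)) (p : Disc × Circle) : Space S T :=
  Quot.mk _ (Sum.inr (j, p))

theorem Space.continuous_ofBundle : Continuous (Space.ofBundle S T) :=
  continuous_quot_mk.comp continuous_inl

theorem Space.continuous_ofSolidTorus (j : Fin (S.m + 1)) :
    Continuous (Space.ofSolidTorus S T j) :=
  continuous_quot_mk.comp (continuous_inr.comp (by fun_prop))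

theorem Space.ofSolidTorus_one (j : Fin (S.m + 1)) :
    Space.ofSolidTorus S T j (Disc.ofCircle 1, 1) =
      Space.ofBundle S T (Surface.annulus j 1 1, 1) := by
  have h := Quot.sound (SpaceRel.glue (S := S) (T := T) j 1 1)
  simp only [one_zpow, mul_one] at h
  exact h

/-- The base point. -/
def Space.base : Space S T := Space.ofBundle S T (Surface.ofWedge (Wedge.base _), 1)

/-- The loop in `Σ_* × {1}` given by a generator of the fundamental group of `Σ_*`. -/
def Space.genLoop (x : Gen S.g S.m) : Path (Space.base S T) (Space.base S T) :=
  (Wedge.petalLoop x).map (f := fun p => Space.ofBundle S T (Surface.ofWedge p, 1))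
    ((Space.continuous_ofBundle S T).comp (Surface.continuous_ofWedge.prodMk continuous_const))

/-- The regular fiber through the base point. -/
def Space.fiberLoop : Path (Space.base S T) (Space.base S T) :=
  circleLoop.map (f := fun t => Space.ofBundle S T (Surface.ofWedge (Wedge.base _), t))
    ((Space.continuous_ofBundle S T).comp (continuous_const.prodMk continuous_id))

/-- The point `(0, 1)` on the core of the `j`-th solid torus. -/
def Space.corePoint (j : Fin (S.m + 1)) : Space S T :=
  Space.ofSolidTorus S T j (Disc.ray 1, 1)

/-- The core `{0} × S¹` of the `j`-th solid torus. -/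
def Space.core (j : Fin (S.m + 1)) : Path (Space.corePoint S T j) (Space.corePoint S T j) :=
  circleLoop.map (f := fun t => Space.ofSolidTorus S T j (Disc.ray 1, t))
    ((Space.continuous_ofSolidTorus S T j).comp (continuous_const.prodMk continuous_id))

/-- The part of the arc from the base point to the `j`-th core inside the `j`-th annulus. -/
def Space.outerArc (j : Fin (S.m + 1)) :
    Path (Space.base S T) (Space.ofBundle S T (Surface.annulus j 1 1, 1)) where
  toFun u := Space.ofBundle S T (Surface.annulus j 1 u, 1)
  continuous_toFun := (Space.continuous_ofBundle S T).comp
    (((Surface.continuous_annulus j).comp (continuous_const.prodMk continuous_id)).prodMk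
      continuous_const)
  source' := by simp only [Surface.annulus_one_zero]; rfl
  target' := rfl

theorem Disc.continuous_ray : Continuous Disc.ray :=
  Continuous.subtype_mk (by fun_prop) _

theorem Disc.ray_zero : Disc.ray 0 = Disc.ofCircle 1 :=
  Subtype.ext (by simp [Disc.ray, Disc.ofCircle])

/-- The part of the arc inside the `j`-th solid torus. -/
def Space.innerArc (j : Fin (S.m + 1)) :
    Path (Space.ofBundle S T (Surface.annulus j 1 1, 1)) (Space.corePoint S T j) where
  toFun r := Space.ofSolidTorus S T j (Disc.ray r, 1)
  continuous_toFun := (Space.continuous_ofSolidTorus S T j).comp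
    (Disc.continuous_ray.prodMk continuous_const)
  source' := by rw [Disc.ray_zero, Space.ofSolidTorus_one]
  target' := rfl

/-- The arc from the base point to the core of the `j`-th solid torus. -/
def Space.arc (j : Fin (S.m + 1)) : Path (Space.base S T) (Space.corePoint S T j) :=
  (Space.outerArc S T j).trans (Space.innerArc S T j)

/-- The homotopy class `ℓ j` of the core of the `j`-th solid torus. -/
def Space.coreClass (j : Fin (S.m + 1)) : PiOne (Space S T) (Space.base S T) :=
  loopClass (((Space.arc S T j).trans (Space.core S T j)).trans (Space.arc S T j).symm)

/-- The homotopy class `h` of the regular fiber. -/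
def Space.fiberClass : PiOne (Space S T) (Space.base S T) := loopClass (Space.fiberLoop S T)

end Loops

/-! ### The cellular chain complex of the Seifert fibered space

The cell decomposition consists of the product cells of `(wedge of circles) × S¹`, and, for each
solid torus, of the core, with its product structure `point ∪ edge`, and the cells swept out by the
cells `point`, `q`, `h`, `q × h` of the boundary torus along the segments of the annulus and the
radii of the disc, from the wedge to the core. -/

/-- The vertices: the base point and a point on each core. -/
abbrev Cell0 (m : ℕ) : Type := Unit ⊕ Fin (m + 1)

abbrev Cell0.base {m : ℕ} : Cell0 m := Sum.inl ()
abbrev Cell0.corePoint {m : ℕ} (j : Fin (m + 1)) : Cell0 m := Sum.inr j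

/-- The edges: the circles of the wedge, the fiber, the cores and the arcs. -/
abbrev Cell1 (g m : ℕ) : Type := (Gen g m ⊕ Unit) ⊕ (Fin (m + 1) ⊕ Fin (m + 1))

abbrev Cell1.gen {g m : ℕ} (x : Gen g m) : Cell1 g m := Sum.inl (Sum.inl x)
abbrev Cell1.fiber {g m : ℕ} : Cell1 g m := Sum.inl (Sum.inr ())
abbrev Cell1.core {g m : ℕ} (j : Fin (m + 1)) : Cell1 g m := Sum.inr (Sum.inl j)
abbrev Cell1.arc {g m : ℕ} (j : Fin (m + 1)) : Cell1 g m := Sum.inr (Sum.inr j)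

/-- The 2-cells: the products (circle of the wedge) × fiber, and the 2-cells swept out by `q j` and
by the fiber. -/
abbrev Cell2 (g m : ℕ) : Type := Gen g m ⊕ (Fin (m + 1) ⊕ Fin (m + 1))

abbrev Cell2.torus {g m : ℕ} (x : Gen g m) : Cell2 g m := Sum.inl x
abbrev Cell2.qSweep {g m : ℕ} (j : Fin (m + 1)) : Cell2 g m := Sum.inr (Sum.inl j)
abbrev Cell2.hSweep {g m : ℕ} (j : Fin (m + 1)) : Cell2 g m := Sum.inr (Sum.inr j)

/-- The 3-cells, swept out by the 2-cells of the boundary tori. -/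
abbrev Cell3 (m : ℕ) : Type := Fin (m + 1)

/-- The initial vertex of an edge. -/
def edgeSource {g m : ℕ} : Cell1 g m → Cell0 m
  | .inl _ => Cell0.base
  | .inr (.inl j) => Cell0.corePoint j
  | .inr (.inr _) => Cell0.base

/-- The terminal vertex of an edge. -/
def edgeTarget {g m : ℕ} : Cell1 g m → Cell0 m
  | .inl _ => Cell0.base
  | .inr (.inl j) => Cell0.corePoint j
  | .inr (.inr j) => Cell0.corePoint j

/-- The edge path `e ^ k` for a closed edge `e`. -/
def edgePow {g m : ℕ} (e : Cell1 g m) (k : ℤ) : List (Cell1 g m × Bool) :=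
  List.replicate k.natAbs (e, decide (0 ≤ k))

/-- The `j`-th boundary word as an edge path. -/
def boundaryEdgePath (g m : ℕ) (j : Fin (m + 1)) : List (Cell1 g m × Bool) :=
  (boundaryWord g m j).map fun x => (Cell1.gen x.1, x.2)

/-- The attaching edge paths of the 2-cells.  On the `j`-th boundary torus `q` and `h` have the
coordinates `(-ν, β)` and `(μ, -α)` in terms of the meridian and the longitude of the solid torus,
so that the radial projection to the core takes `q` to `core ^ β` and `h` to `core ^ (-α)`. -/
def attachingPath (S : SeifertIndex) : Cell2 S.g S.m → List (Cell1 S.g S.m × Bool)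
  | .inl x =>
      [(Cell1.gen x, true), (Cell1.fiber, true), (Cell1.gen x, false), (Cell1.fiber, false)]
  | .inr (.inl j) =>
      boundaryEdgePath S.g S.m j ++ [(Cell1.arc j, true)] ++
        edgePow (Cell1.core j) (-S.slopeβ j) ++ [(Cell1.arc j, false)]
  | .inr (.inr j) =>
      [(Cell1.fiber, true), (Cell1.arc j, true)] ++
        edgePow (Cell1.core j) (S.slopeα j) ++ [(Cell1.arc j, false)]

section FoxCalculus

variable {G : Type} [Group G] {E : Type} [DecidableEq E] (hol : E → G)

/-- The element of `G` determined by an edge path. -/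
def pathHol : List (E × Bool) → G
  | [] => 1
  | (e, true) :: w => hol e * pathHol w
  | (e, false) :: w => (hol e)⁻¹ * pathHol w

/-- Fox calculus: the coefficient, at the lift of the edge `c`, of the 1-chain of the universal
cover given by the lift of an edge path. -/
def foxDeriv : List (E × Bool) → E → MonoidAlgebra ℤ G
  | [], _ => 0
  | (e, true) :: w, c => (if e = c then 1 else 0) + MonoidAlgebra.single (hol e) 1 * foxDeriv w c
  | (e, false) :: w, c =>
      MonoidAlgebra.single (hol e)⁻¹ 1 * (foxDeriv w c - if e = c then 1 else 0)

end FoxCalculus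

section Complex

variable (S : SeifertIndex) {G : Type} [Group G] (hol : Cell1 S.g S.m → G)

/-- An edge `e` is lifted so as to start at the chosen lift of its initial vertex; it ends at
`hol e` times the chosen lift of its terminal vertex. -/
def boundary₁ (e : Cell1 S.g S.m) (v : Cell0 S.m) : MonoidAlgebra ℤ G :=
  (if edgeTarget e = v then MonoidAlgebra.single (hol e) 1 else 0) -
    (if edgeSource e = v then 1 else 0)

/-- The boundary of a 2-cell is the lift of its attaching edge path. -/
def boundary₂ (f : Cell2 S.g S.m) (e : Cell1 S.g S.m) : MonoidAlgebra ℤ G :=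
  foxDeriv hol (attachingPath S f) e

/-- The boundary of the 3-cell `q × h × (arc)` of the `j`-th solid torus:
`(1 - h) (q × arc) + (q - 1) (h × arc) - (q × h)`, where `q` is spelled by the boundary word in the
wedge of circles.  (The face on the core is degenerate.) -/
def boundary₃ (j : Cell3 S.m) : Cell2 S.g S.m → MonoidAlgebra ℤ G
  | .inl x => -foxDeriv hol (boundaryEdgePath S.g S.m j) (Cell1.gen x)
  | .inr (.inl k) =>
      if j = k then 1 - MonoidAlgebra.single (hol Cell1.fiber) 1 else 0
  | .inr (.inr k) =>
      if j = k then MonoidAlgebra.single (pathHol hol (boundaryEdgePath S.g S.m j)) 1 - 1 else 0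

/-- The complex in which `hol e` is the element of the fundamental group given by the edge `e`. -/
def cellComplex : CoverComplex G where
  dim := 3
  cell
    | 0 => Cell0 S.m
    | 1 => Cell1 S.g S.m
    | 2 => Cell2 S.g S.m
    | 3 => Cell3 S.m
    | _ + 4 => Empty
  fintypeCell
    | 0 => inferInstanceAs (Fintype (Cell0 S.m))
    | 1 => inferInstanceAs (Fintype (Cell1 S.g S.m))
    | 2 => inferInstanceAs (Fintype (Cell2 S.g S.m))
    | 3 => inferInstanceAs (Fintype (Cell3 S.m))
    | _ + 4 => inferInstanceAs (Fintype Empty)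
  decEqCell
    | 0 => inferInstanceAs (DecidableEq (Cell0 S.m))
    | 1 => inferInstanceAs (DecidableEq (Cell1 S.g S.m))
    | 2 => inferInstanceAs (DecidableEq (Cell2 S.g S.m))
    | 3 => inferInstanceAs (DecidableEq (Cell3 S.m))
    | _ + 4 => inferInstanceAs (DecidableEq Empty)
  isEmpty_cell
    | 0, h => absurd h (by decide)
    | 1, h => absurd h (by decide)
    | 2, h => absurd h (by decide)
    | 3, h => absurd h (by decide)
    | _ + 4, _ => inferInstanceAs (IsEmpty Empty)
  bdry
    | 0 => boundary₁ S hol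
    | 1 => boundary₂ S hol
    | 2 => boundary₃ S hol
    | _ + 3 => fun c => Empty.elim c

end Complex

/-- The elements of the fundamental group given by the edges, the arcs being the maximal tree along
which the vertices are joined to the base point. -/
def Space.edgeClass (S : SeifertIndex) (T : S.Framing) :
    Cell1 S.g S.m → PiOne (Space S T) (Space.base S T)
  | .inl (.inl x) => loopClass (Space.genLoop S T x)
  | .inl (.inr _) => Space.fiberClass S T
  | .inr (.inl j) => Space.coreClass S T j
  | .inr (.inr _) => 1

/-- The cellular chain complex of the universal cover of the Seifert fibered space. -/
def Space.coverComplex (S : SeifertIndex) (T : S.Framing) :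
    CoverComplex (PiOne (Space S T) (Space.base S T)) :=
  cellComplex S (Space.edgeClass S T)

/-- The representation `ρ_n = σ_n ∘ ρ`. -/
def inducedRep {G : Type} [Group G] (ρ : G →* SL(2, ℂ)) (n : ℕ) :
    Representation ℂ G (BinaryForms n) :=
  (symRep n).comp ρ

end

end SeifertTorsion

namespace SeifertTorsion

/-! ### Loops and the fundamental group -/

section Loops

variable {X : Type} [TopologicalSpace X]

/-! Since `h` acts on `V_{2N}` by `-1` (the forms have odd degree), `h - 1` acts as the invertible
scalar `-2`, and the twisted complex falls apart along a perfect matching of the cells: base point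
with fiber, core point with core, circle of the wedge with its torus cell, arc with the cell swept
by `h`, cell swept by `q` with the 3-cell. Between matched cells the boundary operators are block
diagonal, with blocks `±2` and `ρ(ℓ_j)⁻¹ - 1`. If all blocks are invertible the complex is acyclic
and its torsion is the alternating product of the block determinants
(`CoverComplex.IsReidemeisterTorsion.of_blocks`, `isTorsion_cellComplex`), so `|Tor| =
2^(2N(2g+m-1)) / ∏_{j=0}^m |det(ρ_{2N}(ℓ_j)⁻¹ - 1)|`. `IsTorsion.sq_eq` makes this hold for every
value of the torsion.

Topology enters only through two relations in the fundamental group, `h ℓ_j^α = 1` and `q_j = ℓ_j^β`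
(`Space.loopClass_eq_coreClass_zpow`), obtained from explicit homotopies through the annuli and
solid tori; no presentation of the group is needed.

The first relation gives `ρ(ℓ_j)^α = -I`. Hence `ρ(ℓ_j)` is diagonalizable with eigenvalues `z,
z⁻¹`, where `z` is a primitive root of unity of even order `2λ_j` (`exists_primitiveRoot`). Its
eigenvalues on `V_{2N}` are the odd powers of `z` between `-(2N-1)` and `2N-1`, none equal to 1, so
the determinant has modulus `(∏_{i<N} |z^(2i+1) - 1|)²`. The factors have period `λ_j` in `i`, and
their product over a period is the value of `X^λ + 1` at `1`, namely 2 (`prod_one_sub_pow_odd`).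
Averaging, each core contributes `-log 2 / λ_j` to the limit of `log|Tor| / 2N`. The core with index
0 has `λ_0 = 1`, and the sum is `(2g + m - 2 - ∑_{j≥1} 1/λ_j) log 2`. The limit with `(2N)²` follows
by dividing once more by `2N`. -/

theorem loopClass_trans {x : X} (γ δ : Path x x) :
    loopClass (γ.trans δ) = loopClass γ * loopClass δ := rfl

theorem loopClass_eq_iff {x : X} {γ δ : Path x x} :
    loopClass γ = loopClass δ ↔ γ.Homotopic δ := by
  rw [loopClass, loopClass, MulOpposite.op_inj]
  exact Path.Homotopic.Quotient.eq

/-- Conjugation of a loop by an arc. -/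
noncomputable def lasso {x y : X} (δ : Path x y) (γ : Path y y) : Path x x :=
  (δ.trans γ).trans δ.symm

theorem loopClass_lasso_congr {x y : X} (δ : Path x y) {γ γ' : Path y y} (h : γ.Homotopic γ') :
    loopClass (lasso δ γ) = loopClass (lasso δ γ') :=
  loopClass_eq_iff.2 (((Path.Homotopic.refl δ).hcomp h).hcomp (Path.Homotopic.refl _))

theorem loopClass_lasso_trans {x y z : X} (δ : Path x y) (ε : Path y z) (γ : Path z z) :
    loopClass (lasso (δ.trans ε) γ) = loopClass (lasso δ (lasso ε γ)) := by
  apply congrArg MulOpposite.op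
  simp only [lasso, Path.trans_symm, Path.Homotopic.Quotient.mk_trans,
    Path.Homotopic.Quotient.trans_assoc]

theorem loopClass_lasso_refl {x y : X} (δ : Path x y) :
    loopClass (lasso δ (Path.refl y)) = 1 := by
  refine congrArg MulOpposite.op (a₂ := Path.Homotopic.Quotient.refl x) ?_
  simp [lasso, Path.Homotopic.Quotient.mk_trans]

theorem loopClass_lasso_mul {x y : X} (δ : Path x y) (γ γ' : Path y y) :
    loopClass (lasso δ (γ.trans γ')) = loopClass (lasso δ γ) * loopClass (lasso δ γ') := by
  rw [← loopClass_trans]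
  apply congrArg MulOpposite.op
  simp only [lasso, Path.Homotopic.Quotient.mk_trans, Path.Homotopic.Quotient.trans_assoc]
  rw [← Path.Homotopic.Quotient.trans_assoc (Path.Homotopic.Quotient.mk δ.symm)]
  simp [Path.Homotopic.Quotient.mk_symm]

/-- A free homotopy of loops, during which the base point runs along an arc. -/
theorem loopClass_eq_lasso {a b : X} (H : C(I × I, X)) (γ₀ : Path a a) (γ₁ : Path b b)
    (δ : Path a b) (h₀ : ∀ s, H (s, 0) = γ₀ s) (h₁ : ∀ s, H (s, 1) = γ₁ s)
    (hl : ∀ u, H (0, u) = δ u) (hr : ∀ u, H (1, u) = δ u) :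
    loopClass γ₀ = loopClass (lasso δ γ₁) := by
  rw [loopClass_eq_iff]
  let p : Path ((0, 0) : I × I) (1, 0) :=
    { toFun := fun s => (s, 0), source' := rfl, target' := rfl }
  let l : Path ((0, 0) : I × I) (0, 1) :=
    { toFun := fun u => (0, u), source' := rfl, target' := rfl }
  let t : Path ((0, 1) : I × I) (1, 1) :=
    { toFun := fun s => (s, 1), source' := rfl, target' := rfl }
  let r : Path ((1, 0) : I × I) (1, 1) :=
    { toFun := fun u => (1, u), source' := rfl, target' := rfl }
  have : ContractibleSpace I := (convex_Icc (0 : ℝ) 1).contractibleSpace ⟨0, by simp⟩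
  -- In the simply connected square the bottom edge is homotopic to left edge, top edge, reversed
  -- right edge; `H` carries this homotopy to `X`.
  have key := ((SimplyConnectedSpace.paths_homotopic p ((l.trans t).trans r.symm)).map H).pathCast
    (x₂ := a) (x₃ := a) (by simp [h₀]) (by simp [h₀])
  convert key using 1
  · ext s
    exact (h₀ s).symm
  · ext s
    simp only [lasso, Path.trans_apply, Path.cast_coe, Path.map_coe, Function.comp_apply,
      Path.symm_apply]
    split_ifs
    · exact (hl _).symm
    · exact (h₁ _).symm
    · exact (hr _).symm

/-- The loop running `k` times around the circle. -/
noncomputable def circlePow (k : ℤ) : Path (1 : Circle) 1 where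
  toFun s := circleLoop s ^ k
  source' := by simp
  target' := by simp

theorem circlePow_apply (k : ℤ) (s : I) : circlePow k s = circleLoop s ^ k := rfl

theorem circlePow_eq_exp (k : ℤ) (s : I) :
    circlePow k s = Circle.exp (2 * Real.pi * (k * s)) := by
  change Circle.exp (2 * Real.pi * s) ^ k = _
  rw [← Circle.exp_zsmul]
  congr 1
  simp only [zsmul_eq_mul]
  ring

theorem circlePow_zero : circlePow 0 = Path.refl 1 := by
  ext s
  simp [circlePow_apply]

theorem circlePow_one : circlePow 1 = circleLoop := by
  ext s
  simp [circlePow_apply]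

/-- Both sides lift along `t ↦ exp(2πit)` to paths in `ℝ` from `0` to `k + 1`, and `ℝ` is simply
connected. -/
theorem circlePow_add_one (k : ℤ) :
    (circlePow (k + 1)).Homotopic ((circlePow k).trans (circlePow 1)) := by
  let line (a b : ℝ) : Path a b :=
    { toFun := fun s => a + (b - a) * s
      source' := by simp
      target' := by simp }
  let e : C(ℝ, Circle) := ⟨fun t => Circle.exp (2 * Real.pi * t), by fun_prop⟩
  have he (n : ℤ) : e n = 1 := by
    change Circle.exp (2 * Real.pi * n) = 1
    rw [mul_comm]
    exact Circle.exp_int_mul_two_pi n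
  have he0 : e 0 = 1 := by exact_mod_cast he 0
  have hk : e (k + 1) = 1 := by exact_mod_cast he (k + 1)
  have key := ((SimplyConnectedSpace.paths_homotopic (line 0 (k + 1))
    ((line 0 k).trans (line k (k + 1)))).map e).pathCast (x₂ := 1) (x₃ := 1) he0.symm hk.symm
  convert key using 1
  · ext s
    rw [circlePow_eq_exp]
    simp [e, line]
  · ext s
    simp only [Path.trans_apply, Path.cast_coe, Path.map_coe, Function.comp_apply]
    split_ifs
    · rw [circlePow_eq_exp]
      simp [e, line]
    · rw [circlePow_eq_exp]
      change _ = ((Circle.exp (2 * Real.pi * (k + (k + 1 - k) * _)) : Circle) : ℂ)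
      -- The second half lifts to the segment from `k` to `k + 1`; the offset `k` disappears under
      -- the exponential.
      rw [mul_add, Circle.exp_add]
      have : Circle.exp (2 * Real.pi * k) = 1 := he k
      rw [this, one_mul]
      congr 3
      push_cast
      ring

/-- The loop `z ↦ f (z ^ k)` is the `k`-th power of the loop `f`. -/
theorem loopClass_lasso_circlePow {x : X} {f : Circle → X} (hf : Continuous f)
    (δ : Path x (f 1)) (k : ℤ) :
    loopClass (lasso δ ((circlePow k).map hf)) =
      loopClass (lasso δ (circleLoop.map hf)) ^ k := by
  have add_one (k : ℤ) : loopClass (lasso δ ((circlePow (k + 1)).map hf)) =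
      loopClass (lasso δ ((circlePow k).map hf)) * loopClass (lasso δ (circleLoop.map hf)) := by
    rw [← loopClass_lasso_mul, ← circlePow_one, ← Path.map_trans]
    exact loopClass_lasso_congr δ ((circlePow_add_one k).map ⟨f, hf⟩)
  induction k using Int.induction_on with
  | zero =>
    rw [circlePow_zero, zpow_zero]
    exact loopClass_lasso_refl δ
  | succ k ih => rw [add_one, ih, zpow_add_one]
  | pred k ih =>
    -- Downward induction uses the same recursion, solved for its smaller exponent.
    have h := add_one (-(k : ℤ) - 1)
    rw [sub_add_cancel, ih] at h
    rw [zpow_sub_one, h, mul_inv_cancel_right]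

end Loops

/-! ### Relations between the regular fiber, the boundary words and the cores. -/

section Relations

variable (S : SeifertIndex) (T : S.Framing)

theorem SeifertIndex.Framing.slope_det {S : SeifertIndex} (T : S.Framing) (j : Fin (S.m + 1)) :
    S.slopeα j * T.slopeν j - S.slopeβ j * T.slopeμ j = -1 := by
  induction j using Fin.cases with
  | zero => simp [SeifertIndex.slopeα, SeifertIndex.slopeβ, Framing.slopeμ, Framing.slopeν]
  | succ j => exact T.det j

theorem Space.ofSolidTorus_circle (j : Fin (S.m + 1)) (x y : Circle) :
    Space.ofSolidTorus S T j (Disc.ofCircle x, y) =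
      Space.ofBundle S T (Surface.annulus j (x ^ S.slopeα j * y ^ T.slopeμ j) 1,
        x ^ S.slopeβ j * y ^ T.slopeν j) :=
  Quot.sound (SpaceRel.glue j x y)

/-- The point at distance `1 - r` from the centre on the radius to `x`. -/
noncomputable def Disc.shrink (x : Circle) (r : I) : Disc :=
  ⟨((1 - r : ℝ) : ℂ) * x, by
    rw [mem_closedBall_zero_iff, norm_mul, Circle.norm_coe, mul_one]
    exact mem_closedBall_zero_iff.1 (Disc.ray r).2⟩

theorem Disc.continuous_shrink : Continuous fun p : Circle × I => Disc.shrink p.1 p.2 :=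
  Continuous.subtype_mk (by fun_prop) _

theorem Disc.shrink_zero (x : Circle) : Disc.shrink x 0 = Disc.ofCircle x :=
  Subtype.ext (by simp [Disc.shrink, Disc.ofCircle])

theorem Disc.shrink_one (x : Circle) : Disc.shrink x 1 = Disc.ray 1 :=
  Subtype.ext (by simp [Disc.shrink, Disc.ray])

theorem Disc.shrink_base (r : I) : Disc.shrink 1 r = Disc.ray r :=
  Subtype.ext (by simp [Disc.shrink, Disc.ray])

/-- The loop in the `j`-th boundary torus with direction `(k, l)`, in terms of the coordinates `q`
and `h`. -/
noncomputable def Space.torusLoop (j : Fin (S.m + 1)) (u : I) (k l : ℤ) :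
    Path (Space.ofBundle S T (Surface.annulus j 1 u, 1))
      (Space.ofBundle S T (Surface.annulus j 1 u, 1)) where
  toFun s := Space.ofBundle S T (Surface.annulus j (circlePow k s) u, circlePow l s)
  continuous_toFun := (Space.continuous_ofBundle S T).comp
    (((Surface.continuous_annulus j).comp ((circlePow k).continuous.prodMk continuous_const)).prodMk
      (circlePow l).continuous)
  source' := by simp
  target' := by simp

/-- The loop is pushed across the annulus, from the end `u = 0` on the wedge to the boundary torus
at `u = 1`, while the base point runs along `outerArc`. -/
theorem Space.loopClass_eq_lasso_torusLoop (j : Fin (S.m + 1)) (k l : ℤ)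
    (γ : Path (Space.base S T) (Space.base S T))
    (hγ : ∀ s, γ s = Space.ofBundle S T (Surface.annulus j (circlePow k s) 0, circlePow l s)) :
    loopClass γ = loopClass (lasso (Space.outerArc S T j) (Space.torusLoop S T j 1 k l)) := by
  let H : C(I × I, Space S T) :=
    ⟨fun p => Space.ofBundle S T (Surface.annulus j (circlePow k p.1) p.2, circlePow l p.1),
      (Space.continuous_ofBundle S T).comp
        (((Surface.continuous_annulus j).comp
          (((circlePow k).continuous.comp continuous_fst).prodMk continuous_snd)).prodMk
            ((circlePow l).continuous.comp continuous_fst))⟩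
  refine loopClass_eq_lasso H _ _ _ (fun s => (hγ s).symm) (fun s => rfl) (fun u => ?_)
    (fun u => ?_)
  · change Space.ofBundle S T (Surface.annulus j (circlePow k 0) u, circlePow l 0) = _
    rw [Path.source, Path.source]
    rfl
  · change Space.ofBundle S T (Surface.annulus j (circlePow k 1) u, circlePow l 1) = _
    rw [Path.target, Path.target]
    rfl

/-- In the solid torus, the loop with direction `(c, d)` in terms of the meridian and the longitude
is homotopic to the `d`-th power of the core. -/
theorem Space.loopClass_torusLoop (j : Fin (S.m + 1)) (c d : ℤ) :
    loopClass (Space.torusLoop S T j 1 (S.slopeα j * c + T.slopeμ j * d)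
      (S.slopeβ j * c + T.slopeν j * d)) =
    loopClass (lasso (Space.innerArc S T j) ((circlePow d).map
      (f := fun t => Space.ofSolidTorus S T j (Disc.ray 1, t))
      ((Space.continuous_ofSolidTorus S T j).comp (continuous_const.prodMk continuous_id)))) := by
  -- The homotopy contracts the disc coordinate radially to the centre and keeps the longitude
  -- coordinate.
  let H : C(I × I, Space S T) :=
    ⟨fun p => Space.ofSolidTorus S T j (Disc.shrink (circlePow c p.1) p.2, circlePow d p.1),
      (Space.continuous_ofSolidTorus S T j).comp
        ((Disc.continuous_shrink.comp
          (((circlePow c).continuous.comp continuous_fst).prodMk continuous_snd)).prodMk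
            ((circlePow d).continuous.comp continuous_fst))⟩
  refine loopClass_eq_lasso H _ _ _ (fun s => ?_) (fun s => ?_) (fun u => ?_) (fun u => ?_)
  · change Space.ofSolidTorus S T j (Disc.shrink (circlePow c s) 0, circlePow d s) =
      Space.ofBundle S T (Surface.annulus j (circlePow _ s) 1, circlePow _ s)
    rw [Disc.shrink_zero, Space.ofSolidTorus_circle]
    simp only [circlePow_apply, ← zpow_mul, ← zpow_add, mul_comm]
  · change Space.ofSolidTorus S T j (Disc.shrink (circlePow c s) 1, circlePow d s) =
      Space.ofSolidTorus S T j (Disc.ray 1, circlePow d s)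
    rw [Disc.shrink_one]
  · change Space.ofSolidTorus S T j (Disc.shrink (circlePow c 0) u, circlePow d 0) =
      Space.ofSolidTorus S T j (Disc.ray u, 1)
    rw [Path.source, Path.source, Disc.shrink_base]
  · change Space.ofSolidTorus S T j (Disc.shrink (circlePow c 1) u, circlePow d 1) =
      Space.ofSolidTorus S T j (Disc.ray u, 1)
    rw [Path.target, Path.target, Disc.shrink_base]

/-- The gluing matrix with rows `(α, μ)` and `(β, ν)` has determinant `-1`, and its inverse has rows
`(-ν, μ)` and `(β, -α)`. So the direction `(k, l)` has meridian coordinate `μl - νk` and longitude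
coordinate `βk - αl`; the meridian dies in the solid torus and only the second survives. -/
theorem Space.loopClass_eq_coreClass_zpow (j : Fin (S.m + 1)) (k l : ℤ)
    (γ : Path (Space.base S T) (Space.base S T))
    (hγ : ∀ s, γ s = Space.ofBundle S T (Surface.annulus j (circlePow k s) 0, circlePow l s)) :
    loopClass γ = Space.coreClass S T j ^ (S.slopeβ j * k - S.slopeα j * l) := by
  have hdet := T.slope_det j
  have hk : S.slopeα j * (T.slopeμ j * l - T.slopeν j * k) +
      T.slopeμ j * (S.slopeβ j * k - S.slopeα j * l) = k := by
    linear_combination -k * hdet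
  have hl : S.slopeβ j * (T.slopeμ j * l - T.slopeν j * k) +
      T.slopeν j * (S.slopeβ j * k - S.slopeα j * l) = l := by
    linear_combination -l * hdet
  have h := Space.loopClass_torusLoop S T j (T.slopeμ j * l - T.slopeν j * k)
    (S.slopeβ j * k - S.slopeα j * l)
  rw [hk, hl] at h
  refine (Space.loopClass_eq_lasso_torusLoop S T j k l γ hγ).trans ?_
  refine (loopClass_lasso_congr _ (loopClass_eq_iff.1 h)).trans ?_
  refine (loopClass_lasso_trans _ _ _).symm.trans ?_
  exact loopClass_lasso_circlePow
    (f := fun t => Space.ofSolidTorus S T j (Disc.ray 1, t)) _ (Space.arc S T j) _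

/-- The regular fiber is the `(-α)`-th power of the core. -/
theorem Space.fiberClass_mul_coreClass (j : Fin (S.m + 1)) :
    Space.fiberClass S T * Space.coreClass S T j ^ S.slopeα j = 1 := by
  have h := Space.loopClass_eq_coreClass_zpow S T j 0 1 (Space.fiberLoop S T) fun s => by
    rw [circlePow_zero, circlePow_one, Path.refl_apply, Surface.annulus_one_zero]
    rfl
  rw [Space.fiberClass, h, ← zpow_add]
  simp

theorem Space.loopClass_wordLoop (w : List (Gen S.g S.m × Bool)) :
    loopClass ((Wedge.wordLoop w).map (f := fun p => Space.ofBundle S T (Surface.ofWedge p, 1))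
      ((Space.continuous_ofBundle S T).comp
        (Surface.continuous_ofWedge.prodMk continuous_const))) =
      pathHol (Space.edgeClass S T) (w.map fun x => (Cell1.gen x.1, x.2)) := by
  induction w with
  | nil => rfl
  | cons x w ih =>
    rcases x with ⟨e, _ | _⟩
    · rw [List.map_cons, pathHol, ← ih, Wedge.wordLoop, Path.map_trans, loopClass_trans]
      rfl
    · rw [List.map_cons, pathHol, ← ih, Wedge.wordLoop, Path.map_trans, loopClass_trans]
      rfl

/-- The `j`-th boundary circle of the surface is the `β`-th power of the core. -/
theorem Space.pathHol_boundaryEdgePath (j : Fin (S.m + 1)) :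
    pathHol (Space.edgeClass S T) (boundaryEdgePath S.g S.m j) =
      Space.coreClass S T j ^ S.slopeβ j := by
  rw [boundaryEdgePath, ← Space.loopClass_wordLoop]
  refine (Space.loopClass_eq_coreClass_zpow S T j 1 0 _ fun s => ?_).trans (by simp)
  rw [circlePow_zero, circlePow_one]
  -- The end `u = 0` of the annulus is attached along exactly this word.
  exact congrArg (fun p => Space.ofBundle S T (p, 1))
    (Quot.sound (SurfaceRel.glue (g := S.g) (m := S.m) j s)).symm

end Relations

/-! ### Independence of the torsion of the choices -/

section TorsionChoices

open Module

/-- The orderings `e` and `e'` differ by a permutation, whose sign disappears on squaring; the rest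
is multiplicativity of the determinant. -/
theorem sq_det_comp_equiv {F M ι κ : Type*} [Field F] [AddCommGroup M] [Module F M] [Fintype ι]
    [DecidableEq ι] [Fintype κ] [DecidableEq κ] (c : Basis ι F M) {v w : κ → M} (e e' : ι ≃ κ)
    (A : Matrix κ κ F) (h : ∀ x, v x = ∑ y, A y x • w y) :
    c.det (fun x => v (e' x)) ^ 2 = A.det ^ 2 * c.det (fun x => w (e x)) ^ 2 := by
  have h₁ : c.toMatrix (fun x => v (e' x)) =
      c.toMatrix (fun x => w (e x)) * A.submatrix e e' := by
    ext i x
    rw [Basis.toMatrix_apply, h, Matrix.mul_apply, map_sum, Finsupp.finsetSum_apply,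
      ← e.sum_comp]
    simp [Basis.toMatrix_apply, mul_comm]
  have h₂ : A.submatrix e e' = (A.submatrix e' e').submatrix (e.trans e'.symm) id := by
    ext i x
    simp
  rw [Basis.det_apply, Basis.det_apply, h₁, Matrix.det_mul, h₂, Matrix.det_permute,
    Matrix.det_submatrix_equiv_self, mul_pow, mul_pow]
  have h₃ : (((Equiv.Perm.sign (e.trans e'.symm) : ℤˣ) : ℤ) : F) ^ 2 = 1 := by
    rw [← Int.cast_pow, ← Units.val_pow_eq_pow_val, Int.units_sq]
    simp
  rw [h₃]
  ring

/-- Each intermediate `a i` occurs in two consecutive factors with opposite exponents, so only the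
two ends remain. It serves to cancel the base-change determinants when two values of the torsion are
compared. -/
theorem prod_mul_zpow_alternating {F : Type*} [Field F] (a : ℕ → F) (ha : ∀ i, a i ≠ 0) (n : ℕ) :
    ∏ i ∈ Finset.range (n + 1), (a (i + 1) * a i) ^ ((-1 : ℤ) ^ (i + 1)) =
      a (n + 1) ^ ((-1 : ℤ) ^ (n + 1)) * (a 0)⁻¹ := by
  induction n with
  | zero =>
    rw [Finset.prod_range_one, mul_zpow]
    simp
  | succ n ih =>
    rw [Finset.prod_range_succ, ih, mul_zpow, pow_succ (-1 : ℤ) (n + 1)]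
    have := ha (n + 1)
    rw [mul_neg_one, zpow_neg, zpow_neg]
    field_simp

variable {F : Type*} [Field F] {C : ℕ → Type*} [∀ i, AddCommGroup (C i)] [∀ i, Module F (C i)]
  {d : ∀ i, C (i + 1) →ₗ[F] C i} {ι : ℕ → Type*} [∀ i, Fintype (ι i)] [∀ i, DecidableEq (ι i)]
  {c : ∀ i, Basis (ι i) F (C i)} {n : ℕ} {τ τ' : F}

/-- The torsion is determined up to sign. -/
theorem IsTorsion.sq_eq (hC : Subsingleton (C (n + 1))) (h : IsTorsion C d c n τ)
    (h' : IsTorsion C d c n τ') : τ' ^ 2 = τ ^ 2 := by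
  obtain ⟨hd, r, b, e, hr, hb, rfl⟩ := h
  obtain ⟨-, r', b', e', hr', hb', rfl⟩ := h'
  -- Both `r (i + 1)` and `r' (i + 1)` are the rank of `d i`.
  obtain rfl : r = r' := by
    funext i
    cases i with
    | zero => rw [hr, hr']
    | succ i =>
      have h₁ := finrank_span_eq_card (hb i).1
      have h₂ := finrank_span_eq_card (hb' i).1
      rw [(hb i).2, Fintype.card_fin] at h₁
      rw [(hb' i).2, Fintype.card_fin] at h₂
      exact h₁.symm.trans h₂
  have hspan (i : ℕ) (x : C i) (hx : x ∈ LinearMap.range (d i)) :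
      ∃ u : Fin (r (i + 1)) → F, x = ∑ y, u y • d i (b (i + 1) y) := by
    rw [← (hb i).2, Submodule.mem_span_range_iff_exists_fun] at hx
    obtain ⟨u, hu⟩ := hx
    exact ⟨u, hu.symm⟩
  have hA (i : ℕ) : ∃ A : Matrix (Fin (r (i + 1))) (Fin (r (i + 1))) F,
      ∀ x, d i (b' (i + 1) x) = ∑ y, A y x • d i (b (i + 1) y) := by
    choose u hu using fun x => hspan i (d i (b' (i + 1) x)) ⟨_, rfl⟩
    exact ⟨Matrix.of fun y x => u x y, hu⟩
  choose A₁ hA₁ using hA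
  -- `A i` is the transition matrix between the two families in degree `i`, modulo boundaries. In
  -- degree 0 the families are empty, so `A 0` is an empty matrix.
  let A : ∀ i, Matrix (Fin (r i)) (Fin (r i)) F := fun i =>
    match i with
    | 0 => 1
    | i + 1 => A₁ i
  have hdet (i : ℕ) : (A i).det ≠ 0 := by
    cases i with
    | zero => simp [A]
    | succ i =>
      intro h0
      obtain ⟨u, hu, hu0⟩ := Matrix.exists_mulVec_eq_zero_iff.2 h0
      refine hu (funext fun x => Fintype.linearIndependent_iff.1 (hb' i).1 u ?_ x)
      simp only [hA₁, Finset.smul_sum, smul_smul]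
      rw [Finset.sum_comm]
      refine Finset.sum_eq_zero fun y _ => ?_
      rw [← Finset.sum_smul]
      have := congrFun hu0 y
      simp only [A, Matrix.mulVec, dotProduct, Pi.zero_apply] at this
      simp only [mul_comm (u _), this, zero_smul]
  -- The vector `b' i x` and its `A i`-combination of the `b i` have the same boundary, so by
  -- acyclicity they differ by a boundary. Thus the change of basis in degree `i` is block
  -- triangular with diagonal blocks `A (i + 1)` and `A i`.
  have hQ (i : ℕ) : ∃ Q : Matrix (Fin (r (i + 1))) (Fin (r i)) F,
      ∀ x, b' i x = ∑ y, Q y x • d i (b (i + 1) y) + ∑ y, A i y x • b i y := by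
    have key (x : Fin (r i)) : b' i x - ∑ y, A i y x • b i y ∈ LinearMap.range (d i) := by
      cases i with
      | zero => exact absurd x.2 (by omega)
      | succ i =>
        rw [← hd.2 i, LinearMap.mem_ker, map_sub, map_sum, hA₁]
        simp [A]
    choose u hu using fun x => hspan i _ (key x)
    exact ⟨Matrix.of fun y x => u x y, fun x => by simp [← hu x]⟩
  choose Q hQ using hQ
  have hD (i : ℕ) :
      (c i).det (fun x => Sum.elim (fun k => d i (b' (i + 1) k)) (b' i) (e' i x)) ^ 2 =
      ((A (i + 1)).det ^ 2 * (A i).det ^ 2) *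
      (c i).det (fun x => Sum.elim (fun k => d i (b (i + 1) k)) (b i) (e i x)) ^ 2 := by
    rw [sq_det_comp_equiv (c i) (e i) (e' i) (Matrix.fromBlocks (A (i + 1)) (Q i) 0 (A i)),
      Matrix.det_fromBlocks_zero₂₁, mul_pow]
    rintro (x | x)
    · simpa [A] using hA₁ i x
    · simpa using hQ i x
  -- With `C (n + 1)` trivial the vectors `b (n + 1)` vanish, yet their boundaries are independent:
  -- there are none. Hence both end terms of the telescoped product are empty determinants.
  have hn : IsEmpty (Fin (r (n + 1))) := by
    refine ⟨fun k => (hb n).1.ne_zero k ?_⟩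
    simp only [Subsingleton.elim (b (n + 1) k) 0, map_zero]
  have h0 : IsEmpty (Fin (r 0)) := by
    rw [hr]
    infer_instance
  simp only [← Finset.prod_pow]
  simp only [← zpow_natCast, zpow_comm _ _ ((2 : ℕ) : ℤ)]
  simp only [zpow_natCast, hD]
  simp only [mul_zpow _ (Basis.det _ _ ^ 2), Finset.prod_mul_distrib]
  rw [prod_mul_zpow_alternating (fun i => (A i).det ^ 2) fun i => pow_ne_zero 2 (hdet i)]
  simp [Matrix.det_isEmpty]

/-- A chain complex is acyclic, and its torsion is known, if there are vectors in every degree which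
form a basis together with the boundaries of those in the next degree. -/
theorem isTorsion_of_det_ne_zero (hdd : ∀ i x, d i (d (i + 1) x) = 0) {κ : ℕ → Type*}
    [∀ i, Fintype (κ i)] [IsEmpty (κ 0)] (b : ∀ i, κ i → C i)
    (e : ∀ i, ι i ≃ κ (i + 1) ⊕ κ i)
    (hdet : ∀ i, (c i).det
      (fun x => Sum.elim (fun k => d i (b (i + 1) k)) (b i) (e i x)) ≠ 0) (n : ℕ) :
    IsTorsion C d c n (∏ i ∈ Finset.range (n + 1), (c i).det
      (fun x => Sum.elim (fun k => d i (b (i + 1) k)) (b i) (e i x)) ^ ((-1 : ℤ) ^ (i + 1))) := by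
  have hbasis (i : ℕ) := (Basis.is_basis_iff_det (c i)).2 (isUnit_iff_ne_zero.2 (hdet i))
  have hli (i : ℕ) : LinearIndependent F (Sum.elim (fun k => d i (b (i + 1) k)) (b i)) :=
    (linearIndependent_equiv (e i)).1 (hbasis i).1
  have hsp (i : ℕ) (x : C i) :
      ∃ (u : κ (i + 1) → F) (v : κ i → F),
        x = ∑ k, u k • d i (b (i + 1) k) + ∑ k, v k • b i k := by
    have hx : x ∈ Submodule.span F (Set.range fun x =>
        Sum.elim (fun k => d i (b (i + 1) k)) (b i) (e i x)) := by
      rw [(hbasis i).2]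
      trivial
    obtain ⟨u, hu⟩ := (Submodule.mem_span_range_iff_exists_fun F).1 hx
    refine ⟨fun k => u ((e i).symm (Sum.inl k)), fun k => u ((e i).symm (Sum.inr k)), ?_⟩
    rw [← hu, ← (e i).symm.sum_comp, Fintype.sum_sum_type]
    simp
  have hli' (i : ℕ) : LinearIndependent F (fun k => d i (b (i + 1) k)) :=
    (hli i).comp Sum.inl Sum.inl_injective
  have hrange (i : ℕ) (x : C (i + 1)) :
      ∃ v : κ (i + 1) → F, d i x = ∑ k, v k • d i (b (i + 1) k) := by
    obtain ⟨u, v, rfl⟩ := hsp (i + 1) x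
    exact ⟨v, by simp [hdd]⟩
  have hac : IsAcyclic C d := by
    refine ⟨?_, fun i => le_antisymm (fun x hx => ?_) ?_⟩
    · rw [eq_top_iff]
      rintro x -
      obtain ⟨u, v, rfl⟩ := hsp 0 x
      refine ⟨∑ k, u k • b 1 k, ?_⟩
      simp
    -- Expand a cycle in the new basis: the boundaries of the `b (i + 1)` are independent, so its `b
    -- (i + 1)`-part is zero and only boundaries remain.
    · obtain ⟨u, v, rfl⟩ := hsp (i + 1) x
      rw [LinearMap.mem_ker] at hx
      have hv := Fintype.linearIndependent_iff.1 (hli' i) v (by simpa [hdd] using hx)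
      refine ⟨∑ k, u k • b (i + 2) k, ?_⟩
      simp [hv]
    · rintro _ ⟨x, rfl⟩
      exact hdd i x
  let f (i : ℕ) : κ i ≃ Fin (Fintype.card (κ i)) := Fintype.equivFin (κ i)
  refine ⟨hac, fun i => Fintype.card (κ i), fun i k => b i ((f i).symm k),
    fun i => (e i).trans ((f (i + 1)).sumCongr (f i)), Fintype.card_eq_zero, fun i => ⟨?_, ?_⟩, ?_⟩
  · exact (hli' i).comp (f (i + 1)).symm (f (i + 1)).symm.injective
  · refine le_antisymm (Submodule.span_le.2 ?_) ?_
    · rintro _ ⟨k, rfl⟩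
      exact ⟨_, rfl⟩
    · rintro _ ⟨x, rfl⟩
      obtain ⟨v, hv⟩ := hrange i x
      rw [hv]
      refine Submodule.sum_mem _ fun k _ => Submodule.smul_mem _ _ (Submodule.subset_span ?_)
      exact ⟨f (i + 1) k, by simp⟩
  · refine Finset.prod_congr rfl fun i _ => ?_
    congr 2
    funext x
    simp only [Equiv.trans_apply]
    rcases e i x with k | k <;> simp

end TorsionChoices

/-! ### Torsion of a twisted complex with block diagonal boundary operators -/

section Blocks

open Module

variable {G : Type} [Group G] {V : Type} [AddCommGroup V] [Module ℂ V]

theorem CoverComplex.twistedBoundary_single (K : CoverComplex G) (ρ : Representation ℂ G V) (i : ℕ)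
    (x : K.cell (i + 1)) (v : V) (y : K.cell i) :
    K.twistedBoundary ρ i (Pi.single x v) y = rightAction ρ (K.bdry i x y) v := by
  simp only [CoverComplex.twistedBoundary, LinearMap.pi_apply, LinearMap.sum_apply,
    LinearMap.comp_apply, LinearMap.proj_apply]
  rw [Finset.sum_eq_single x]
  · simp
  · intro z _ hz
    simp [Pi.single_eq_of_ne hz]
  · simp

/-- `Y i` indexes the cells of degree `i` matched downward, `Y (i + 1)` those of degree `i` matched
upward. With the vectors on downward matched cells as `b i`, the matrix of the new basis of degree
`i` is block triangular: an identity on `Y i`, and the blocks `A i y` on `Y (i + 1)`. Boundary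
components landing on downward matched cells do not affect the determinant. -/
theorem CoverComplex.IsReidemeisterTorsion.of_blocks [FiniteDimensional ℂ V]
    (K : CoverComplex G) (ρ : Representation ℂ G V)
    (hdd : ∀ i x, K.twistedBoundary ρ i (K.twistedBoundary ρ (i + 1) x) = 0)
    {Y : ℕ → Type} [∀ i, Fintype (Y i)] [∀ i, DecidableEq (Y i)] [IsEmpty (Y 0)]
    (φ : ∀ i, K.cell i ≃ Y (i + 1) ⊕ Y i) (A : ∀ i, Y (i + 1) → (V →ₗ[ℂ] V))
    (hA : ∀ i y, (A i y).det ≠ 0)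
    (hdiag : ∀ i y, rightAction ρ
      (K.bdry i ((φ (i + 1)).symm (Sum.inr y)) ((φ i).symm (Sum.inl y))) = A i y)
    (hoff : ∀ i y y', y ≠ y' → rightAction ρ
      (K.bdry i ((φ (i + 1)).symm (Sum.inr y)) ((φ i).symm (Sum.inl y'))) = 0)
    (B : Basis (Fin (finrank ℂ V)) ℂ V) :
    IsTorsion (K.TwistedChain V) (K.twistedBoundary ρ)
      (fun i => Pi.basis fun _ : K.cell i => B) K.dim
      (∏ i ∈ Finset.range (K.dim + 1), (∏ y, (A i y).det) ^ ((-1 : ℤ) ^ (i + 1))) := by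
  let b (i : ℕ) (p : Fin (finrank ℂ V) × Y i) : K.TwistedChain V i :=
    Pi.single ((φ i).symm (Sum.inr p.2)) (B p.1)
  let e (i : ℕ) : (Σ _ : K.cell i, Fin (finrank ℂ V)) ≃
      (Fin (finrank ℂ V) × Y (i + 1)) ⊕ (Fin (finrank ℂ V) × Y i) :=
    ((Equiv.sigmaEquivProd _ _).trans (Equiv.prodComm _ _)).trans
      (((Equiv.refl _).prodCongr (φ i)).trans (Equiv.prodSumDistrib _ _ _))
  have hdet (i : ℕ) : (Pi.basis fun _ : K.cell i => B).det (fun x => Sum.elim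
      (fun k => K.twistedBoundary ρ i (b (i + 1) k)) (b i) (e i x)) = ∏ y, (A i y).det := by
    let M := ((Pi.basis fun _ : K.cell i => B).toMatrix (fun x => Sum.elim
      (fun k => K.twistedBoundary ρ i (b (i + 1) k)) (b i) (e i x))).submatrix
        (e i).symm (e i).symm
    have hM : M = Matrix.fromBlocks
        (Matrix.blockDiagonal fun y => LinearMap.toMatrix B B (A i y)) 0 M.toBlocks₂₁ 1 := by
      refine (Matrix.fromBlocks_toBlocks M).symm.trans ?_
      congr 1
      · ext ⟨k, y⟩ ⟨k', y'⟩
        simp only [M, b, e, Matrix.toBlocks₁₁, Matrix.of_apply, Matrix.submatrix_apply,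
          Basis.toMatrix_apply, Pi.basis_repr, Equiv.apply_symm_apply, Sum.elim_inl,
          CoverComplex.twistedBoundary_single]
        simp only [Equiv.symm_trans_apply, Equiv.prodSumDistrib_symm_apply_left,
          Equiv.prodCongr_symm, Equiv.prodCongr_apply, Prod.map, Equiv.prodComm_symm,
          Equiv.prodComm_apply, Prod.swap, Equiv.sigmaEquivProd_symm_apply,
          Matrix.blockDiagonal_apply, LinearMap.toMatrix_apply, Equiv.refl_symm, Equiv.refl_apply]
        by_cases h : y = y'
        · simp [h, hdiag]
        · simp [h, hoff i _ _ (Ne.symm h)]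
      · ext ⟨k, y⟩ ⟨k', y'⟩
        simp [M, b, e, Matrix.toBlocks₁₂, Basis.toMatrix_apply]
      · ext ⟨k, y⟩ ⟨k', y'⟩
        simp only [M, b, e, Matrix.toBlocks₂₂, Matrix.of_apply, Matrix.submatrix_apply,
          Basis.toMatrix_apply, Pi.basis_repr, Equiv.apply_symm_apply, Sum.elim_inr]
        by_cases h : y = y'
        · subst h
          simp [Matrix.one_apply, Finsupp.single_apply, eq_comm]
        · simp [h]
    rw [Basis.det_apply, ← Matrix.det_submatrix_equiv_self (e i).symm]
    change M.det = _
    rw [hM, Matrix.det_fromBlocks_zero₁₂, Matrix.det_blockDiagonal, Matrix.det_one, mul_one]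
    simp only [LinearMap.det_toMatrix]
  have := isTorsion_of_det_ne_zero (c := fun i => Pi.basis fun _ : K.cell i => B) hdd b e
    (fun i => by rw [hdet i]; exact Finset.prod_ne_zero_iff.2 fun y _ => hA i y) K.dim
  simpa only [hdet] using this

end Blocks

/-! ### Fox calculus -/

section Fox

open MonoidAlgebra

variable {G : Type} [Group G] {E : Type} (hol : E → G)

theorem pathHol_append (w w' : List (E × Bool)) :
    pathHol hol (w ++ w') = pathHol hol w * pathHol hol w' := by
  induction w with
  | nil => simp [pathHol]
  | cons x w ih => rcases x with ⟨e, _ | _⟩ <;> simp [pathHol, ih, mul_assoc]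

theorem pathHol_replicate_true (e : E) (k : ℕ) :
    pathHol hol (List.replicate k (e, true)) = hol e ^ k := by
  induction k with
  | zero => simp [pathHol]
  | succ k ih => rw [List.replicate_succ, pathHol, ih, pow_succ']

theorem pathHol_replicate_false (e : E) (k : ℕ) :
    pathHol hol (List.replicate k (e, false)) = (hol e)⁻¹ ^ k := by
  induction k with
  | zero => simp [pathHol]
  | succ k ih => rw [List.replicate_succ, pathHol, ih, pow_succ']

theorem pathHol_edgePow {g m : ℕ} (hol : Cell1 g m → G) (e : Cell1 g m) (k : ℤ) :
    pathHol hol (edgePow e k) = hol e ^ k := by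
  rcases le_or_gt 0 k with h | h
  · rw [edgePow, decide_eq_true h, pathHol_replicate_true, ← zpow_natCast,
      Int.natAbs_of_nonneg h]
  · rw [edgePow, decide_eq_false h.not_ge, pathHol_replicate_false, inv_pow, ← zpow_natCast,
      ← zpow_neg, Int.ofNat_natAbs_of_nonpos h.le, neg_neg]

variable [DecidableEq E]

theorem foxDeriv_append (w w' : List (E × Bool)) (c : E) :
    foxDeriv hol (w ++ w') c =
      foxDeriv hol w c + single (pathHol hol w) 1 * foxDeriv hol w' c := by
  induction w with
  | nil => simp [foxDeriv, pathHol, ← one_def]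
  | cons x w ih =>
    rcases x with ⟨e, _ | _⟩
    · rw [List.cons_append, foxDeriv, ih, foxDeriv, pathHol, ← one_mul (1 : ℤ),
        ← single_mul_single, one_mul]
      noncomm_ring
    · rw [List.cons_append, foxDeriv, ih, foxDeriv, pathHol, ← one_mul (1 : ℤ),
        ← single_mul_single, one_mul]
      noncomm_ring

theorem foxDeriv_eq_zero (w : List (E × Bool)) (c : E) (h : ∀ x ∈ w, x.1 ≠ c) :
    foxDeriv hol w c = 0 := by
  induction w with
  | nil => rfl
  | cons x w ih =>
    have h₁ := h x List.mem_cons_self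
    have h₂ := ih fun y hy => h y (List.mem_cons_of_mem x hy)
    rcases x with ⟨e, _ | _⟩ <;> simp only [foxDeriv, h₂, if_neg h₁] <;> simp

theorem foxDeriv_edge (e c : E) : foxDeriv hol [(e, true)] c = if e = c then 1 else 0 := by
  simp [foxDeriv]

theorem foxDeriv_edge_inv (e c : E) :
    foxDeriv hol [(e, false)] c = if e = c then -single (hol e)⁻¹ 1 else 0 := by
  split_ifs with h <;> simp [foxDeriv, h]

/-- The fundamental formula of Fox calculus. -/
theorem sum_foxDeriv_mul [Fintype E] (f : E → MonoidAlgebra ℤ G) (a : MonoidAlgebra ℤ G)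
    (w : List (E × Bool)) (h : ∀ x ∈ w, f x.1 = (single (hol x.1) 1 - 1) * a) :
    ∑ e, foxDeriv hol w e * f e = (single (pathHol hol w) 1 - 1) * a := by
  induction w with
  | nil => simp [foxDeriv, pathHol, ← one_def]
  | cons x w ih =>
    have h₁ := h x List.mem_cons_self
    have h₂ := ih fun y hy => h y (List.mem_cons_of_mem x hy)
    rcases x with ⟨e, _ | _⟩
    · simp only [foxDeriv, pathHol, mul_assoc, sub_mul, ← Finset.mul_sum, Finset.sum_sub_distrib,
        h₂, ite_mul, one_mul, zero_mul, Finset.sum_ite_eq, Finset.mem_univ, if_true]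
      simp only at h₁
      rw [h₁, ← one_mul (1 : ℤ), ← single_mul_single, one_mul]
      have : single (hol e)⁻¹ (1 : ℤ) * single (hol e) 1 = 1 := by
        rw [single_mul_single, inv_mul_cancel, one_mul, ← one_def]
      simp only [sub_mul, one_mul, mul_sub, ← mul_assoc, this]
      abel
    · simp only [foxDeriv, pathHol, mul_assoc, add_mul, ← Finset.mul_sum, Finset.sum_add_distrib,
        h₂, ite_mul, one_mul, zero_mul, Finset.sum_ite_eq, Finset.mem_univ, if_true]
      simp only at h₁
      rw [h₁, ← one_mul (1 : ℤ), ← single_mul_single, one_mul]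
      noncomm_ring

/-- The derivative of a word in one letter is a geometric sum, here multiplied out with `e - 1`. -/
theorem foxDeriv_mul_of_forall_eq (e : E) (w : List (E × Bool)) (h : ∀ x ∈ w, x.1 = e) :
    foxDeriv hol w e * (single (hol e) 1 - 1) = single (pathHol hol w) 1 - 1 := by
  induction w with
  | nil => simp [foxDeriv, pathHol, ← one_def]
  | cons x w ih =>
    have h₁ := h x List.mem_cons_self
    have h₂ := ih fun y hy => h y (List.mem_cons_of_mem x hy)
    rcases x with ⟨e', _ | _⟩
    · obtain rfl : e' = e := h₁
      have : single (hol e')⁻¹ (1 : ℤ) * single (hol e') 1 = 1 := by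
        rw [single_mul_single, inv_mul_cancel, one_mul, ← one_def]
      rw [foxDeriv, pathHol, mul_assoc, sub_mul, h₂, if_pos rfl, ← one_mul (1 : ℤ),
        ← single_mul_single, one_mul, one_mul, sub_sub_sub_cancel_right, mul_sub, this]
    · obtain rfl : e' = e := h₁
      rw [foxDeriv, pathHol, add_mul, mul_assoc, h₂, if_pos rfl, ← one_mul (1 : ℤ),
        ← single_mul_single, one_mul, one_mul, mul_sub, mul_one]
      abel

end Fox

/-! ### The right action as a ring homomorphism -/

section RightAction

open MonoidAlgebra

variable {G : Type} [Group G] {V : Type} [AddCommGroup V] [Module ℂ V]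

/-- The right action of `ℤ[G]`, as a homomorphism to the opposite of the endomorphism ring. -/
noncomputable def rightActionHom (ρ : Representation ℂ G V) :
    MonoidAlgebra ℤ G →+* (Module.End ℂ V)ᵐᵒᵖ :=
  (MonoidAlgebra.lift ℤ (Module.End ℂ V)ᵐᵒᵖ G
    { toFun := fun γ => MulOpposite.op (ρ γ⁻¹)
      map_one' := by simp
      map_mul' := fun a b => by simp }).toRingHom

theorem rightActionHom_apply (ρ : Representation ℂ G V) (a : MonoidAlgebra ℤ G) :
    rightActionHom ρ a = MulOpposite.op (rightAction ρ a) := by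
  apply MulOpposite.unop_injective
  simp only [rightActionHom, rightAction, AlgHom.toRingHom_eq_coe, RingHom.coe_coe,
    MonoidAlgebra.lift_apply, MonoidHom.coe_mk, OneHom.coe_mk, Finsupp.sum]
  rw [Finset.unop_sum]
  rfl

theorem rightActionHom_single (ρ : Representation ℂ G V) (γ : G) :
    rightActionHom ρ (single γ 1) = MulOpposite.op (ρ γ⁻¹) := by
  rw [rightActionHom_apply, rightAction]
  simp

/-- Only the image of the product of the boundary matrices under the action has to vanish, not the
product in `ℤ[G]`. This makes `ρ(h) = -1` available when checking `∂∂ = 0`. -/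
theorem CoverComplex.twistedBoundary_twistedBoundary (K : CoverComplex G)
    (ρ : Representation ℂ G V) (i : ℕ)
    (h : ∀ c c', rightActionHom ρ (∑ e, K.bdry (i + 1) c e * K.bdry i e c') = 0)
    (x : K.TwistedChain V (i + 2)) :
    K.twistedBoundary ρ i (K.twistedBoundary ρ (i + 1) x) = 0 := by
  suffices hc : K.twistedBoundary ρ i ∘ₗ K.twistedBoundary ρ (i + 1) = 0 from
    LinearMap.congr_fun hc x
  refine LinearMap.pi_ext fun c v => funext fun c' => ?_
  simp only [LinearMap.comp_apply, LinearMap.zero_apply, Pi.zero_apply]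
  have h' := congrArg (fun f => f.unop v) (h c c')
  simp only [map_sum, map_mul, rightActionHom_apply, ← MulOpposite.op_mul, ← Finset.op_sum,
    MulOpposite.unop_op, MulOpposite.unop_zero, LinearMap.zero_apply, LinearMap.sum_apply,
    Module.End.mul_apply] at h'
  rw [← h', CoverComplex.twistedBoundary]
  simp only [LinearMap.pi_apply, LinearMap.sum_apply, LinearMap.comp_apply, LinearMap.proj_apply]
  exact Finset.sum_congr rfl fun e _ => congrArg _ (K.twistedBoundary_single ρ (i + 1) c v e)

end RightAction

/-! ### The twisted chain complex of a Seifert fibered space -/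

section SeifertComplex

open MonoidAlgebra

variable {S : SeifertIndex} {G : Type} [Group G] {hol : Cell1 S.g S.m → G}

theorem boundary₁_gen (x : Gen S.g S.m) (v : Cell0 S.m) :
    boundary₁ S hol (Cell1.gen x) v =
      (single (hol (Cell1.gen x)) 1 - 1) * if Cell0.base = v then 1 else 0 := by
  change (if Cell0.base = v then single (hol (Cell1.gen x)) 1 else 0) -
    (if Cell0.base = v then 1 else 0) = _
  split_ifs <;> simp

theorem boundary₁_fiber (v : Cell0 S.m) :
    boundary₁ S hol Cell1.fiber v =
      (single (hol Cell1.fiber) 1 - 1) * if Cell0.base = v then 1 else 0 := by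
  change (if Cell0.base = v then single (hol (Cell1.fiber)) 1 else 0) -
    (if Cell0.base = v then 1 else 0) = _
  split_ifs <;> simp

theorem boundary₁_core (j : Fin (S.m + 1)) (v : Cell0 S.m) :
    boundary₁ S hol (Cell1.core j) v =
      (single (hol (Cell1.core j)) 1 - 1) * if Cell0.corePoint j = v then 1 else 0 := by
  change (if Cell0.corePoint j = v then single (hol (Cell1.core j)) 1 else 0) -
    (if Cell0.corePoint j = v then 1 else 0) = _
  split_ifs <;> simp

theorem fst_eq_of_mem_edgePow {g m : ℕ} {e : Cell1 g m} {k : ℤ} {x : Cell1 g m × Bool}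
    (h : x ∈ edgePow e k) : x.1 = e := by
  rw [List.eq_of_mem_replicate h]

theorem exists_of_mem_boundaryEdgePath {g m : ℕ} {j : Fin (m + 1)} {x : Cell1 g m × Bool}
    (h : x ∈ boundaryEdgePath g m j) : ∃ y, x.1 = Cell1.gen y := by
  obtain ⟨y, -, rfl⟩ := List.mem_map.1 h
  exact ⟨y.1, rfl⟩

theorem foxDeriv_boundaryEdgePath_eq_zero (j : Fin (S.m + 1)) {e : Cell1 S.g S.m}
    (he : ∀ y, Cell1.gen y ≠ e) : foxDeriv hol (boundaryEdgePath S.g S.m j) e = 0 := by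
  refine foxDeriv_eq_zero hol _ _ fun x hx => ?_
  obtain ⟨y, hy⟩ := exists_of_mem_boundaryEdgePath hx
  rw [hy]
  exact he y

theorem foxDeriv_edgePow_eq_zero {e e' : Cell1 S.g S.m} (k : ℤ) (he : e ≠ e') :
    foxDeriv hol (edgePow e k) e' = 0 :=
  foxDeriv_eq_zero hol _ _ fun x hx => by rwa [fst_eq_of_mem_edgePow hx]

theorem foxDeriv_edgePow_mul (e : Cell1 S.g S.m) (k : ℤ) :
    foxDeriv hol (edgePow e k) e * (single (hol e) 1 - 1) = single (hol e ^ k) 1 - 1 := by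
  rw [foxDeriv_mul_of_forall_eq hol e _ fun x hx => fst_eq_of_mem_edgePow hx, pathHol_edgePow]

theorem boundary₂_torus_gen (x y : Gen S.g S.m) :
    boundary₂ S hol (Cell2.torus x) (Cell1.gen y) =
      if x = y then
        1 + single (hol (Cell1.gen x)) 1 * (single (hol Cell1.fiber) 1 *
          -single (hol (Cell1.gen x))⁻¹ 1)
      else 0 := by
  simp only [boundary₂, attachingPath, foxDeriv]
  by_cases h : x = y <;> simp [h]

theorem boundary₂_torus_fiber (x : Gen S.g S.m) :
    boundary₂ S hol (Cell2.torus x) Cell1.fiber =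
      single (hol (Cell1.gen x)) 1 * (1 + single (hol Cell1.fiber) 1 *
          (single (hol (Cell1.gen x))⁻¹ 1 * -single (hol Cell1.fiber)⁻¹ 1)) := by
  simp [boundary₂, attachingPath, foxDeriv]

theorem boundary₂_torus_core (x : Gen S.g S.m) (k : Fin (S.m + 1)) :
    boundary₂ S hol (Cell2.torus x) (Cell1.core k) = 0 := by
  simp [boundary₂, attachingPath, foxDeriv]

theorem boundary₂_torus_arc (x : Gen S.g S.m) (k : Fin (S.m + 1)) :
    boundary₂ S hol (Cell2.torus x) (Cell1.arc k) = 0 := by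
  simp [boundary₂, attachingPath, foxDeriv]

theorem boundary₂_hSweep_gen (j : Fin (S.m + 1)) (y : Gen S.g S.m) :
    boundary₂ S hol (Cell2.hSweep j) (Cell1.gen y) = 0 := by
  simp only [boundary₂, attachingPath, foxDeriv_append]
  rw [foxDeriv_edgePow_eq_zero _ (by simp)]
  simp [foxDeriv]

theorem boundary₂_hSweep_fiber (j : Fin (S.m + 1)) :
    boundary₂ S hol (Cell2.hSweep j) Cell1.fiber = 1 := by
  simp only [boundary₂, attachingPath, foxDeriv_append]
  rw [foxDeriv_edgePow_eq_zero _ (by simp)]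
  simp [foxDeriv]

theorem boundary₂_qSweep_gen (j : Fin (S.m + 1)) (y : Gen S.g S.m) :
    boundary₂ S hol (Cell2.qSweep j) (Cell1.gen y) =
      foxDeriv hol (boundaryEdgePath S.g S.m j) (Cell1.gen y) := by
  simp only [boundary₂, attachingPath, foxDeriv_append]
  rw [foxDeriv_edgePow_eq_zero _ (by simp)]
  simp [foxDeriv]

theorem boundary₂_qSweep_fiber (j : Fin (S.m + 1)) :
    boundary₂ S hol (Cell2.qSweep j) Cell1.fiber = 0 := by
  simp only [boundary₂, attachingPath, foxDeriv_append]
  rw [foxDeriv_edgePow_eq_zero _ (by simp), foxDeriv_boundaryEdgePath_eq_zero _ (by simp)]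
  simp [foxDeriv]

variable (harc : ∀ j, hol (Cell1.arc j) = 1)
include harc

theorem boundary₁_arc (j : Fin (S.m + 1)) (v : Cell0 S.m) :
    boundary₁ S hol (Cell1.arc j) v =
      (if Cell0.corePoint j = v then 1 else 0) - if Cell0.base = v then 1 else 0 := by
  change (if Cell0.corePoint j = v then single (hol (Cell1.arc j)) 1 else 0) -
    (if Cell0.base = v then 1 else 0) = _
  rw [harc, ← one_def]

theorem boundary₂_hSweep_core (j k : Fin (S.m + 1)) :
    boundary₂ S hol (Cell2.hSweep j) (Cell1.core k) =
      if j = k then single (hol Cell1.fiber) 1 *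
        foxDeriv hol (edgePow (Cell1.core j) (S.slopeα j)) (Cell1.core j) else 0 := by
  simp only [boundary₂, attachingPath, foxDeriv_append]
  by_cases h : j = k
  · subst h
    simp [foxDeriv, pathHol, harc]
  · rw [foxDeriv_edgePow_eq_zero _ (by simpa using h)]
    simp [foxDeriv, h]

theorem boundary₂_qSweep_core (j k : Fin (S.m + 1)) :
    boundary₂ S hol (Cell2.qSweep j) (Cell1.core k) =
      if j = k then single (pathHol hol (boundaryEdgePath S.g S.m j)) 1 *
        foxDeriv hol (edgePow (Cell1.core j) (-S.slopeβ j)) (Cell1.core j) else 0 := by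
  simp only [boundary₂, attachingPath, foxDeriv_append]
  rw [foxDeriv_boundaryEdgePath_eq_zero _ (by simp)]
  by_cases h : j = k
  · subst h
    simp [foxDeriv, pathHol, pathHol_append, harc]
  · rw [foxDeriv_edgePow_eq_zero _ (by simpa using h)]
    simp [foxDeriv, h]

variable (hcore : ∀ j, hol Cell1.fiber * hol (Cell1.core j) ^ S.slopeα j = 1)
  (hbd : ∀ j, pathHol hol (boundaryEdgePath S.g S.m j) = hol (Cell1.core j) ^ S.slopeβ j)

section
include hcore

/-- The attaching path crosses the arc outward at `h` and returns along it at `h ℓ^α = 1`. -/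
theorem boundary₂_hSweep_arc (j k : Fin (S.m + 1)) :
    boundary₂ S hol (Cell2.hSweep j) (Cell1.arc k) =
      if j = k then single (hol Cell1.fiber) 1 - 1 else 0 := by
  simp only [boundary₂, attachingPath, foxDeriv_append]
  rw [foxDeriv_edgePow_eq_zero _ (by simp)]
  by_cases h : j = k
  · subst h
    simp [foxDeriv, pathHol, pathHol_edgePow, harc, hcore, ← one_def, sub_eq_add_neg]
  · simp [foxDeriv, h]

end

section
include hbd

/-- The arc is crossed outward at `q` and backward at `q ℓ^(-β) = 1`. -/
theorem boundary₂_qSweep_arc (j k : Fin (S.m + 1)) :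
    boundary₂ S hol (Cell2.qSweep j) (Cell1.arc k) =
      if j = k then single (pathHol hol (boundaryEdgePath S.g S.m j)) 1 - 1 else 0 := by
  simp only [boundary₂, attachingPath, foxDeriv_append]
  rw [foxDeriv_boundaryEdgePath_eq_zero _ (by simp), foxDeriv_edgePow_eq_zero _ (by simp)]
  by_cases h : j = k
  · subst h
    simp [foxDeriv, pathHol, pathHol_append, pathHol_edgePow, harc, hbd, ← one_def, sub_eq_add_neg]
  · simp [foxDeriv, h]

/-- The attaching path visits two vertices, so the fundamental formula is applied separately to the
piece at the base point and the piece at the core. With the two arc terms the contributions at each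
vertex telescope, because the path closes up in `G`. -/
theorem sum_boundary₂_qSweep_mul_boundary₁ (j : Fin (S.m + 1)) (v : Cell0 S.m) :
    ∑ e, boundary₂ S hol (Cell2.qSweep j) e * boundary₁ S hol e v = 0 := by
  have h₁ := sum_foxDeriv_mul hol (fun e => boundary₁ S hol e v) (if Cell0.base = v then 1 else 0)
    (boundaryEdgePath S.g S.m j) fun x hx => by
      obtain ⟨y, hy⟩ := exists_of_mem_boundaryEdgePath hx
      rw [hy, boundary₁_gen]
  have h₂ := sum_foxDeriv_mul hol (fun e => boundary₁ S hol e v)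
    (if Cell0.corePoint j = v then 1 else 0) (edgePow (Cell1.core j) (-S.slopeβ j)) fun x hx => by
      rw [fst_eq_of_mem_edgePow hx, boundary₁_core]
  simp only [boundary₂, attachingPath, foxDeriv_append, foxDeriv_edge, foxDeriv_edge_inv, add_mul,
    Finset.sum_add_distrib, mul_assoc, ← Finset.mul_sum, h₁, h₂, ite_mul, zero_mul, one_mul,
    Finset.sum_ite_eq, Finset.mem_univ, if_true, boundary₁_arc harc, pathHol_append,
    pathHol_edgePow, hbd, zpow_neg]
  simp only [pathHol, harc, ← one_def, mul_sub, single_mul_single, one_mul, mul_one,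
    mul_inv_cancel, mul_ite, mul_zero, inv_one, mul_neg]
  split_ifs <;> (simp; try abel)

end

section
include hcore

theorem sum_boundary₂_hSweep_mul_boundary₁ (j : Fin (S.m + 1)) (v : Cell0 S.m) :
    ∑ e, boundary₂ S hol (Cell2.hSweep j) e * boundary₁ S hol e v = 0 := by
  have h₂ := sum_foxDeriv_mul hol (fun e => boundary₁ S hol e v)
    (if Cell0.corePoint j = v then 1 else 0) (edgePow (Cell1.core j) (S.slopeα j)) fun x hx => by
      rw [fst_eq_of_mem_edgePow hx, boundary₁_core]
  -- The first two letters are split apart so that the product rule isolates the fiber from the arc.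
  have h₃ : attachingPath S (Cell2.hSweep j) = [(Cell1.fiber, true)] ++ [(Cell1.arc j, true)] ++
      edgePow (Cell1.core j) (S.slopeα j) ++ [(Cell1.arc j, false)] := rfl
  simp only [boundary₂, h₃, foxDeriv_append, foxDeriv_edge, foxDeriv_edge_inv, add_mul,
    Finset.sum_add_distrib, mul_assoc, ← Finset.mul_sum, h₂, ite_mul, zero_mul, one_mul,
    Finset.sum_ite_eq, Finset.mem_univ, if_true, boundary₁_arc harc, boundary₁_fiber,
    pathHol_append, pathHol_edgePow]
  simp only [pathHol, harc, ← one_def, mul_sub, single_mul_single, one_mul, mul_one,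
    hcore, mul_ite, mul_zero, inv_one, mul_neg]
  split_ifs <;> (simp; try abel)

end

end SeifertComplex

/-! ### The identity `∂∂ = 0` when the fiber acts by `-1`. -/

section TwistedSeifertComplex

open MonoidAlgebra

variable {S : SeifertIndex} {G : Type} [Group G] {hol : Cell1 S.g S.m → G} {V : Type}
  [AddCommGroup V] [Module ℂ V] {ρ : Representation ℂ G V}

section Fiber

variable (hfib : ρ (hol Cell1.fiber) = -1)
include hfib

theorem rightActionHom_fiber : rightActionHom ρ (single (hol Cell1.fiber) 1) = -1 := by
  have h : ρ (hol Cell1.fiber)⁻¹ = -1 := by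
    have h₁ : ρ (hol Cell1.fiber)⁻¹ * ρ (hol Cell1.fiber) = 1 := by
      rw [← map_mul, inv_mul_cancel, map_one]
    rw [hfib, mul_neg_one] at h₁
    rw [← h₁, neg_neg]
  rw [rightActionHom_single, h, MulOpposite.op_neg, MulOpposite.op_one]

theorem rightActionHom_fiber_sub_one :
    rightActionHom ρ (single (hol Cell1.fiber) 1 - 1) = -2 := by
  rw [map_sub, map_one, rightActionHom_fiber hfib]
  norm_num

theorem rightActionHom_one_sub_fiber :
    rightActionHom ρ (1 - single (hol Cell1.fiber) 1) = 2 := by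
  rw [map_sub, map_one, rightActionHom_fiber hfib]
  norm_num

theorem rightActionHom_fiber_inv : rightActionHom ρ (single (hol Cell1.fiber)⁻¹ 1) = -1 := by
  rw [rightActionHom_single, inv_inv, hfib, MulOpposite.op_neg, MulOpposite.op_one]

omit hfib in
theorem rightActionHom_mul_inv (γ : G) :
    rightActionHom ρ (single γ 1) * rightActionHom ρ (single γ⁻¹ 1) = 1 := by
  rw [← map_mul, single_mul_single, mul_inv_cancel, one_mul, ← one_def, map_one]

/-- The coefficient is `1 - x h x⁻¹`, and a conjugate of `h` also acts by the central element `-1`.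
-/
theorem rightActionHom_boundary₂_torus_gen (x y : Gen S.g S.m) :
    rightActionHom ρ (boundary₂ S hol (Cell2.torus x) (Cell1.gen y)) = if x = y then 2 else 0 := by
  rw [boundary₂_torus_gen]
  split_ifs
  · simp only [map_add, map_mul, map_neg, map_one, rightActionHom_fiber hfib, neg_mul, one_mul,
      neg_neg, rightActionHom_mul_inv]
    norm_num
  · simp

theorem rightActionHom_boundary₂_torus_fiber (x : Gen S.g S.m) :
    rightActionHom ρ (boundary₂ S hol (Cell2.torus x) Cell1.fiber) =
      rightActionHom ρ (single (hol (Cell1.gen x)) 1 - 1) := by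
  rw [boundary₂_torus_fiber]
  simp only [map_add, map_sub, map_mul, map_neg, map_one, rightActionHom_fiber hfib,
    rightActionHom_fiber_inv hfib, neg_mul, one_mul, neg_neg, mul_one, mul_add, mul_neg,
    rightActionHom_mul_inv]
  abel

/-- The fundamental formula leaves `[x, h] - 1`, which acts by zero because `h` acts by a scalar;
the relation `[x, h] = 1` in `G` is not needed. -/
theorem rightActionHom_sum_boundary₂_torus (x : Gen S.g S.m) (v : Cell0 S.m) :
    rightActionHom ρ (∑ e, boundary₂ S hol (Cell2.torus x) e * boundary₁ S hol e v) = 0 := by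
  have h := sum_foxDeriv_mul hol (fun e => boundary₁ S hol e v) (if Cell0.base = v then 1 else 0)
    (attachingPath S (Cell2.torus x)) fun y hy => by
      simp only [attachingPath, List.mem_cons, List.not_mem_nil, or_false] at hy
      rcases hy with rfl | rfl | rfl | rfl <;> simp only [boundary₁_gen, boundary₁_fiber]
  have h₁ : single (pathHol hol (attachingPath S (Cell2.torus x))) (1 : ℤ) =
      single (hol (Cell1.gen x)) 1 * (single (hol Cell1.fiber) 1 *
        (single (hol (Cell1.gen x))⁻¹ 1 * single (hol Cell1.fiber)⁻¹ 1)) := by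
    simp [attachingPath, pathHol, single_mul_single]
  simp only [boundary₂, h, h₁, map_mul, map_sub, map_one, rightActionHom_fiber hfib,
    rightActionHom_fiber_inv hfib, neg_mul, one_mul, mul_neg, mul_one, neg_neg,
    rightActionHom_mul_inv, sub_self, zero_mul]

end Fiber

theorem sum_boundary₃_mul (j : Cell3 S.m) (F : Cell2 S.g S.m → MonoidAlgebra ℤ G) :
    ∑ f, boundary₃ S hol j f * F f =
      -∑ x, foxDeriv hol (boundaryEdgePath S.g S.m j) (Cell1.gen x) * F (Cell2.torus x) +
      ((1 - single (hol Cell1.fiber) 1) * F (Cell2.qSweep j) +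
        (single (pathHol hol (boundaryEdgePath S.g S.m j)) 1 - 1) * F (Cell2.hSweep j)) := by
  rw [Fintype.sum_sum_type (α₁ := Gen S.g S.m) (α₂ := Fin (S.m + 1) ⊕ Fin (S.m + 1)),
    Fintype.sum_sum_type (α₁ := Fin (S.m + 1)), ← Finset.sum_neg_distrib]
  congr 1
  · exact Finset.sum_congr rfl fun x _ =>
      neg_mul (foxDeriv hol (boundaryEdgePath S.g S.m j) (Cell1.gen x)) (F (Cell2.torus x))
  · simp [boundary₃, ite_mul]

variable (harc : ∀ j, hol (Cell1.arc j) = 1) (hfib : ρ (hol Cell1.fiber) = -1)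
  (hcore : ∀ j, hol Cell1.fiber * hol (Cell1.core j) ^ S.slopeα j = 1)
  (hbd : ∀ j, pathHol hol (boundaryEdgePath S.g S.m j) = hol (Cell1.core j) ^ S.slopeβ j)
  (hunit : ∀ j, IsUnit (rightActionHom ρ (single (hol (Cell1.core j)) 1 - 1)))
include harc hfib hcore hbd hunit

/-- Since `1 - h` acts as the scalar `2`, the terms cancel edge by edge: on the wedge, twice the Fox
derivative against itself; on the fiber, by the fundamental formula; on the arcs, `2(q - 1)` against
`-2(q - 1)`. The core needs the invertibility of `ℓ - 1`. -/
theorem rightActionHom_sum_boundary₃ (j : Cell3 S.m) (e : Cell1 S.g S.m) :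
    rightActionHom ρ (∑ f, boundary₃ S hol j f * boundary₂ S hol f e) = 0 := by
  have h2 := rightActionHom_one_sub_fiber hfib
  rw [sum_boundary₃_mul]
  rcases e with (y | ⟨⟩) | (k | k)
  · change rightActionHom ρ (-∑ x, _ * boundary₂ S hol (Cell2.torus x) (Cell1.gen y) +
      (_ * boundary₂ S hol _ (Cell1.gen y) + _ * boundary₂ S hol _ (Cell1.gen y))) = 0
    simp only [map_add, map_neg, map_sum, map_mul, rightActionHom_boundary₂_torus_gen hfib,
      boundary₂_hSweep_gen, boundary₂_qSweep_gen, h2]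
    simp [two_mul, mul_two]
  · change rightActionHom ρ (-∑ x, _ * boundary₂ S hol (Cell2.torus x) Cell1.fiber +
      (_ * boundary₂ S hol _ Cell1.fiber + _ * boundary₂ S hol _ Cell1.fiber)) = 0
    -- With `a = 1` the formula writes `q - 1` through Fox derivatives; edges outside the wedge
    -- contribute nothing.
    have h := sum_foxDeriv_mul hol (fun e => single (hol e) 1 - 1) 1
      (boundaryEdgePath S.g S.m j) fun x _ => (mul_one _).symm
    rw [Fintype.sum_sum_type, Fintype.sum_sum_type,
      Fintype.sum_eq_zero _ fun y : Unit =>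
        by rw [foxDeriv_boundaryEdgePath_eq_zero _ (by simp), zero_mul],
      Fintype.sum_eq_zero _ fun y : Fin (S.m + 1) ⊕ Fin (S.m + 1) =>
        by rw [foxDeriv_boundaryEdgePath_eq_zero _ (by simp), zero_mul], add_zero, add_zero] at h
    have h' := congrArg (rightActionHom ρ) h
    simp only [map_sum, map_mul] at h'
    simp only [map_add, map_neg, map_sum, map_mul, rightActionHom_boundary₂_torus_fiber hfib, h',
      boundary₂_hSweep_fiber, boundary₂_qSweep_fiber]
    simp
  · change rightActionHom ρ (-∑ x, _ * boundary₂ S hol (Cell2.torus x) (Cell1.core k) +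
      (_ * boundary₂ S hol _ (Cell1.core k) + _ * boundary₂ S hol _ (Cell1.core k))) = 0
    simp only [boundary₂_torus_core, boundary₂_qSweep_core harc, boundary₂_hSweep_core harc]
    split_ifs with h
    · subst h
      -- Multiplying by the unit `ℓ - 1` turns the two geometric sums into `ℓ^(-β) - 1` and `ℓ^α -
      -- 1`, where the relations `q = ℓ^β` and `h ℓ^α = 1` apply.
      rw [← (hunit j).mul_left_eq_zero, ← map_mul]
      simp only [mul_zero, Finset.sum_const_zero, neg_zero, zero_add, add_mul, mul_assoc,
        foxDeriv_edgePow_mul]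
      simp only [mul_sub, single_mul_single, hbd, ← zpow_add, hcore, add_neg_cancel, zpow_zero,
        ← one_def, mul_one]
      simp only [map_add, map_sub, map_mul, map_one, rightActionHom_fiber hfib]
      noncomm_ring
    · simp
  · change rightActionHom ρ (-∑ x, _ * boundary₂ S hol (Cell2.torus x) (Cell1.arc k) +
      (_ * boundary₂ S hol _ (Cell1.arc k) + _ * boundary₂ S hol _ (Cell1.arc k))) = 0
    simp only [boundary₂_torus_arc, boundary₂_qSweep_arc harc hbd,
      boundary₂_hSweep_arc harc hcore]
    split_ifs with h
    · simp only [map_add, map_sub, map_mul, map_one, map_neg, rightActionHom_fiber hfib, mul_zero,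
        Finset.sum_const_zero, map_zero]
      noncomm_ring
    · simp

theorem cellComplex_twistedBoundary_twistedBoundary (i : ℕ)
    (x : (cellComplex S hol).TwistedChain V (i + 2)) :
    (cellComplex S hol).twistedBoundary ρ i ((cellComplex S hol).twistedBoundary ρ (i + 1) x) =
      0 := by
  refine (cellComplex S hol).twistedBoundary_twistedBoundary ρ i (fun c c' => ?_) x
  match i, c, c' with
  | 0, .inl f, v => exact rightActionHom_sum_boundary₂_torus hfib f v
  | 0, .inr (.inl j), v =>
    exact (congrArg _ (sum_boundary₂_qSweep_mul_boundary₁ harc hbd j v)).trans (map_zero _)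
  | 0, .inr (.inr j), v =>
    exact (congrArg _ (sum_boundary₂_hSweep_mul_boundary₁ harc hcore j v)).trans (map_zero _)
  | 1, j, e => exact rightActionHom_sum_boundary₃ harc hfib hcore hbd hunit j e
  | _ + 2, c, _ => exact Empty.elim c

end TwistedSeifertComplex

/-! ### The torsion of the twisted complex -/

section SeifertTorsionValue

open MonoidAlgebra Module

/-- The cells of positive degree which the boundary operator matches with cells one degree lower:
the fiber and the cores, the 2-cells over the circles of the wedge and those swept out by the
fiber, and all the 3-cells. -/
def UpperCell (g m : ℕ) : ℕ → Type
  | 0 => Empty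
  | 1 => Unit ⊕ Fin (m + 1)
  | 2 => Gen g m ⊕ Fin (m + 1)
  | 3 => Fin (m + 1)
  | _ + 4 => Empty

instance (g m : ℕ) : ∀ i, Fintype (UpperCell g m i)
  | 0 => inferInstanceAs (Fintype Empty)
  | 1 => inferInstanceAs (Fintype (Unit ⊕ Fin (m + 1)))
  | 2 => inferInstanceAs (Fintype (Gen g m ⊕ Fin (m + 1)))
  | 3 => inferInstanceAs (Fintype (Fin (m + 1)))
  | _ + 4 => inferInstanceAs (Fintype Empty)

instance (g m : ℕ) : ∀ i, DecidableEq (UpperCell g m i)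
  | 0 => inferInstanceAs (DecidableEq Empty)
  | 1 => inferInstanceAs (DecidableEq (Unit ⊕ Fin (m + 1)))
  | 2 => inferInstanceAs (DecidableEq (Gen g m ⊕ Fin (m + 1)))
  | 3 => inferInstanceAs (DecidableEq (Fin (m + 1)))
  | _ + 4 => inferInstanceAs (DecidableEq Empty)

instance (g m : ℕ) : IsEmpty (UpperCell g m 0) := inferInstanceAs (IsEmpty Empty)

variable {S : SeifertIndex} {G : Type} [Group G] {hol : Cell1 S.g S.m → G}

/-- Every cell is either matched with a cell one degree higher or with one a degree lower. -/
def cellMatching (S : SeifertIndex) (hol : Cell1 S.g S.m → G) :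
    ∀ i, (cellComplex S hol).cell i ≃ UpperCell S.g S.m (i + 1) ⊕ UpperCell S.g S.m i
  | 0 => (Equiv.sumEmpty (Unit ⊕ Fin (S.m + 1)) Empty).symm
  | 1 =>
    { toFun := fun e => match e with
        | .inl (.inl x) => .inl (.inl x)
        | .inl (.inr u) => .inr (.inl u)
        | .inr (.inl j) => .inr (.inr j)
        | .inr (.inr j) => .inl (.inr j)
      invFun := fun y => match y with
        | .inl (.inl x) => .inl (.inl x)
        | .inr (.inl u) => .inl (.inr u)
        | .inr (.inr j) => .inr (.inl j)
        | .inl (.inr j) => .inr (.inr j)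
      left_inv := by rintro ((x | x) | (x | x)) <;> rfl
      right_inv := by rintro ((x | x) | (x | x)) <;> rfl }
  | 2 =>
    { toFun := fun e => match e with
        | .inl x => .inr (.inl x)
        | .inr (.inl j) => .inl j
        | .inr (.inr j) => .inr (.inr j)
      invFun := fun y => match y with
        | .inr (.inl x) => .inl x
        | .inl j => .inr (.inl j)
        | .inr (.inr j) => .inr (.inr j)
      left_inv := by rintro (x | (x | x)) <;> rfl
      right_inv := by rintro (x | (x | x)) <;> rfl }
  | 3 => (Equiv.emptySum Empty (Fin (S.m + 1))).symm
  | _ + 4 => (Equiv.emptySum Empty Empty).symm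

variable {V : Type} [AddCommGroup V] [Module ℂ V]

/-- The blocks of the twisted boundary operators between matched cells. -/
noncomputable def matchingBlock (S : SeifertIndex) (hol : Cell1 S.g S.m → G)
    (ρ : Representation ℂ G V) : ∀ i, UpperCell S.g S.m (i + 1) → (V →ₗ[ℂ] V)
  | 0 => fun y => match y with
    | .inl _ => -2
    | .inr j => rightAction ρ (single (hol (Cell1.core j)) 1 - 1)
  | 1 => fun y => match y with
    | .inl _ => 2
    | .inr _ => -2
  | 2 => fun _ => 2
  | _ + 3 => fun y => Empty.elim y

theorem rightAction_eq_of_rightActionHom {ρ : Representation ℂ G V} {a : MonoidAlgebra ℤ G}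
    {f : Module.End ℂ V} (h : rightActionHom ρ a = MulOpposite.op f) : rightAction ρ a = f :=
  MulOpposite.op_injective ((rightActionHom_apply ρ a).symm.trans h)

variable {ρ : Representation ℂ G V}
variable (harc : ∀ j, hol (Cell1.arc j) = 1) (hfib : ρ (hol Cell1.fiber) = -1)
  (hcore : ∀ j, hol Cell1.fiber * hol (Cell1.core j) ^ S.slopeα j = 1)
include harc hfib hcore

theorem rightAction_matching (i : ℕ) (y : UpperCell S.g S.m (i + 1)) :
    rightAction ρ ((cellComplex S hol).bdry i ((cellMatching S hol (i + 1)).symm (Sum.inr y))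
      ((cellMatching S hol i).symm (Sum.inl y))) = matchingBlock S hol ρ i y := by
  apply rightAction_eq_of_rightActionHom
  match i, y with
  | 0, .inl u =>
    change rightActionHom ρ (boundary₁ S hol Cell1.fiber Cell0.base) = -2
    rw [boundary₁_fiber, if_pos rfl, mul_one, rightActionHom_fiber_sub_one hfib]
  | 0, .inr j =>
    change rightActionHom ρ (boundary₁ S hol (Cell1.core j) (Cell0.corePoint j)) = _
    rw [boundary₁_core, if_pos rfl, mul_one, rightActionHom_apply]
    rfl
  | 1, .inl x =>
    change rightActionHom ρ (boundary₂ S hol (Cell2.torus x) (Cell1.gen x)) = 2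
    rw [rightActionHom_boundary₂_torus_gen hfib, if_pos rfl]
  | 1, .inr j =>
    change rightActionHom ρ (boundary₂ S hol (Cell2.hSweep j) (Cell1.arc j)) = -2
    rw [boundary₂_hSweep_arc harc hcore, if_pos rfl, rightActionHom_fiber_sub_one hfib]
  | 2, j =>
    change rightActionHom ρ (if j = j then 1 - single (hol Cell1.fiber) 1 else 0) = 2
    rw [if_pos rfl, rightActionHom_one_sub_fiber hfib]
  | _ + 3, y => exact Empty.elim y

theorem rightAction_not_matching (i : ℕ) (y y' : UpperCell S.g S.m (i + 1)) (h : y ≠ y') :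
    rightAction ρ ((cellComplex S hol).bdry i ((cellMatching S hol (i + 1)).symm (Sum.inr y))
      ((cellMatching S hol i).symm (Sum.inl y'))) = 0 := by
  apply rightAction_eq_of_rightActionHom
  rw [MulOpposite.op_zero]
  match i, y, y' with
  | 0, .inl _, .inl _ => exact absurd rfl h
  | 0, .inl u, .inr j =>
    change rightActionHom ρ (boundary₁ S hol Cell1.fiber (Cell0.corePoint j)) = 0
    rw [boundary₁_fiber, if_neg (by rintro ⟨⟩), mul_zero, map_zero]
  | 0, .inr j, .inl u =>
    change rightActionHom ρ (boundary₁ S hol (Cell1.core j) Cell0.base) = 0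
    rw [boundary₁_core, if_neg (by rintro ⟨⟩), mul_zero, map_zero]
  | 0, .inr j, .inr k =>
    change rightActionHom ρ (boundary₁ S hol (Cell1.core j) (Cell0.corePoint k)) = 0
    rw [boundary₁_core, if_neg (by rintro ⟨⟩; exact h rfl), mul_zero, map_zero]
  | 1, .inl x, .inl y =>
    change rightActionHom ρ (boundary₂ S hol (Cell2.torus x) (Cell1.gen y)) = 0
    rw [rightActionHom_boundary₂_torus_gen hfib, if_neg (by rintro rfl; exact h rfl)]
  | 1, .inl x, .inr k =>
    change rightActionHom ρ (boundary₂ S hol (Cell2.torus x) (Cell1.arc k)) = 0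
    rw [boundary₂_torus_arc, map_zero]
  | 1, .inr j, .inl y =>
    change rightActionHom ρ (boundary₂ S hol (Cell2.hSweep j) (Cell1.gen y)) = 0
    rw [boundary₂_hSweep_gen, map_zero]
  | 1, .inr j, .inr k =>
    change rightActionHom ρ (boundary₂ S hol (Cell2.hSweep j) (Cell1.arc k)) = 0
    rw [boundary₂_hSweep_arc harc hcore, if_neg (by rintro rfl; exact h rfl), map_zero]
  | 2, j, k =>
    change rightActionHom ρ (if j = k then 1 - single (hol Cell1.fiber) 1 else 0) = 0
    rw [if_neg h, map_zero]
  | _ + 3, y, _ => exact Empty.elim y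

omit harc hfib hcore in
theorem rightAction_core_sub_one (j : Fin (S.m + 1)) :
    rightAction ρ (single (hol (Cell1.core j)) 1 - 1) = ρ (hol (Cell1.core j))⁻¹ - 1 := by
  apply rightAction_eq_of_rightActionHom
  rw [map_sub, map_one, rightActionHom_single]
  rfl

variable (hbd : ∀ j, pathHol hol (boundaryEdgePath S.g S.m j) = hol (Cell1.core j) ^ S.slopeβ j)
  (hdet : ∀ j, LinearMap.det (ρ (hol (Cell1.core j))⁻¹ - 1) ≠ 0)
include hbd hdet

/-- The torsion of the twisted complex of a Seifert fibered space, if `h` acts by `-1`. -/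
theorem isTorsion_cellComplex [FiniteDimensional ℂ V] (B : Basis (Fin (finrank ℂ V)) ℂ V) :
    ∃ τ : ℂ, IsTorsion ((cellComplex S hol).TwistedChain V)
      ((cellComplex S hol).twistedBoundary ρ)
      (fun i => Pi.basis fun _ : (cellComplex S hol).cell i => B) (cellComplex S hol).dim τ ∧
      ‖τ‖ = (2 ^ finrank ℂ V) ^ (2 * S.g + S.m) /
        (2 ^ finrank ℂ V * ∏ j, ‖LinearMap.det (ρ (hol (Cell1.core j))⁻¹ - 1)‖) := by
  have hunit (j : Fin (S.m + 1)) : IsUnit (rightActionHom ρ (single (hol (Cell1.core j)) 1 - 1)) := by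
    rw [rightActionHom_apply, rightAction_core_sub_one, isUnit_op,
      LinearMap.isUnit_iff_isUnit_det]
    exact (hdet j).isUnit
  have h2 : LinearMap.det (2 : V →ₗ[ℂ] V) = 2 ^ finrank ℂ V := by
    have : (2 : V →ₗ[ℂ] V) = (2 : ℂ) • LinearMap.id := by
      ext
      simp [two_smul]
    rw [this, LinearMap.det_smul, LinearMap.det_id, mul_one]
  have hneg2 : LinearMap.det (-2 : V →ₗ[ℂ] V) = (-2) ^ finrank ℂ V := by
    have : (-2 : V →ₗ[ℂ] V) = (-2 : ℂ) • LinearMap.id := by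
      ext
      simp [two_smul]
    rw [this, LinearMap.det_smul, LinearMap.det_id, mul_one]
  refine ⟨_, CoverComplex.IsReidemeisterTorsion.of_blocks (cellComplex S hol) ρ
    (cellComplex_twistedBoundary_twistedBoundary harc hfib hcore hbd hunit)
    (cellMatching S hol) (matchingBlock S hol ρ) (fun i y => ?_)
    (rightAction_matching harc hfib hcore) (rightAction_not_matching harc hfib hcore) B, ?_⟩
  · match i, y with
    | 0, .inl u => exact hneg2.trans_ne (by simp)
    | 0, .inr j =>
      change LinearMap.det (rightAction ρ _) ≠ 0
      rw [rightAction_core_sub_one]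
      exact hdet j
    | 1, .inl x => exact h2.trans_ne (by simp)
    | 1, .inr j => exact hneg2.trans_ne (by simp)
    | 2, j => exact h2.trans_ne (by simp)
    | _ + 3, y => exact Empty.elim y
  · have h0 : ∏ y, (matchingBlock S hol ρ 0 y).det = (-2) ^ finrank ℂ V *
        ∏ j, LinearMap.det (ρ (hol (Cell1.core j))⁻¹ - 1) := by
      refine (Fintype.prod_sum_type (α₁ := Unit) (α₂ := Fin (S.m + 1)) _).trans ?_
      congr 1
      · exact (Fintype.prod_unique _).trans hneg2
      · refine Finset.prod_congr rfl fun j _ => ?_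
        rw [← rightAction_core_sub_one]
        rfl
    have h1 : ∏ y, (matchingBlock S hol ρ 1 y).det =
        (2 ^ finrank ℂ V) ^ (2 * S.g + S.m) * ((-2) ^ finrank ℂ V) ^ (S.m + 1) := by
      refine (Fintype.prod_sum_type (α₁ := Gen S.g S.m) (α₂ := Fin (S.m + 1)) _).trans ?_
      congr 1
      · refine (Finset.prod_congr rfl fun j _ => h2).trans ?_
        simp [two_mul]
      · refine (Finset.prod_congr rfl fun j _ => hneg2).trans ?_
        simp
    have h3 : ∏ y, (matchingBlock S hol ρ 2 y).det = (2 ^ finrank ℂ V) ^ (S.m + 1) :=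
      (Finset.prod_congr (ι := Fin (S.m + 1)) rfl fun j _ => h2).trans (Fin.prod_const _ _)
    have h4 : ∏ y, (matchingBlock S hol ρ 3 y).det = 1 :=
      Finset.prod_of_isEmpty (ι := Empty) _
    change ‖∏ i ∈ Finset.range 4, _‖ = _
    -- Degrees 0, 1, 2 enter with exponents `-1, 1, -1`, and degree 3 is trivial. In absolute value
    -- the powers of `2 ^ finrank ℂ V` add up to `-1 + (2g + m) + (m + 1) - (m + 1)`.
    rw [Finset.prod_range_succ, Finset.prod_range_succ, Finset.prod_range_succ,
      Finset.prod_range_one, h0, h1, h3, h4]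
    have hne : ∏ j, ‖LinearMap.det (ρ (hol (Cell1.core j))⁻¹ - 1)‖ ≠ 0 :=
      Finset.prod_ne_zero_iff.2 fun j _ => norm_ne_zero_iff.2 (hdet j)
    simp
    field_simp

end SeifertTorsionValue

/-! ### Diagonalization of elements of `SL(2, ℂ)` of finite order -/

section Diagonalization

open Matrix

/-- The binomial theorem stops after the linear term. It shows that a Jordan block with nonzero
eigenvalue has no scalar positive power. -/
theorem smul_one_add_pow_of_mul_self_eq_zero {R : Type*} [Ring R] [Algebra ℂ R] {x : R}
    (hx : x * x = 0) (z : ℂ) (k : ℕ) :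
    (z • 1 + x) ^ (k + 1) = z ^ (k + 1) • (1 : R) + ((k + 1) * z ^ k : ℂ) • x := by
  induction k with
  | zero => simp
  | succ k ih =>
    rw [pow_succ, ih]
    simp only [add_mul, mul_add, smul_mul_assoc, one_mul, mul_smul_comm, mul_one, hx, smul_zero,
      add_zero]
    push_cast
    module

/-- A matrix in `SL(2, ℂ)` one of whose powers is `-1` is diagonalizable. -/
theorem exists_diagonalization (A : Matrix (Fin 2) (Fin 2) ℂ) (hA : A.det = 1) {a : ℕ}
    (ha : a ≠ 0) (h : A ^ a = -1) :
    ∃ (z : ℂ) (P : Matrix (Fin 2) (Fin 2) ℂ), z ≠ 0 ∧ P.det ≠ 0 ∧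
      A * P = P * diagonal ![z, z⁻¹] := by
  rw [det_fin_two] at hA
  by_cases hdiag : A 0 1 = 0 ∧ A 1 0 = 0
  · have h₁ : A 0 0 * A 1 1 = 1 := by simpa [hdiag] using hA
    refine ⟨A 0 0, 1, left_ne_zero_of_mul_eq_one h₁, by simp, ?_⟩
    rw [← eq_inv_of_mul_eq_one_right h₁]
    ext i j
    fin_cases i <;> fin_cases j <;> simp [hdiag]
  -- `w` is a square root of the discriminant of the characteristic polynomial, and `z`, `y` are its
  -- two roots.
  obtain ⟨w, hw⟩ := IsAlgClosed.exists_pow_nat_eq ((A 0 0 + A 1 1) ^ 2 - 4) zero_lt_two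
  obtain ⟨z, y, hzy, hsum⟩ : ∃ z y : ℂ, z * y = 1 ∧ z + y = A 0 0 + A 1 1 :=
    ⟨(A 0 0 + A 1 1 + w) / 2, (A 0 0 + A 1 1 - w) / 2, by linear_combination -(1 / 4 : ℂ) * hw,
      by ring⟩
  have hy' : y = z⁻¹ := eq_inv_of_mul_eq_one_right hzy
  by_cases hne : z = y
  · exfalso
    obtain ⟨k, rfl⟩ := Nat.exists_eq_succ_of_ne_zero ha
    -- Cayley–Hamilton for a double eigenvalue. As `A ^ a` is scalar, the nilpotent part has no
    -- off-diagonal entries, contrary to `hdiag`.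
    have hx : (A - z • 1) * (A - z • 1) = 0 := by
      have htr : A 1 1 = 2 * z - A 0 0 := by linear_combination -hsum - hne
      have hzz : z * z = 1 := by rw [← hzy, ← hne]
      rw [htr] at hA
      ext i j
      fin_cases i <;> fin_cases j <;> simp [mul_apply, Fin.sum_univ_two, htr]
      · linear_combination hzz - hA
      · ring
      · ring
      · linear_combination hzz - hA
    have hpow := smul_one_add_pow_of_mul_self_eq_zero hx z k
    rw [add_sub_cancel, h] at hpow
    have hc : ((k + 1) * z ^ k : ℂ) ≠ 0 :=
      mul_ne_zero (by exact_mod_cast k.succ_ne_zero)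
        (pow_ne_zero _ (left_ne_zero_of_mul_eq_one hzy))
    have h₀₁ : 0 = (k + 1) * z ^ k * A 0 1 := by simpa using congrFun (congrFun hpow 0) 1
    have h₁₀ : 0 = (k + 1) * z ^ k * A 1 0 := by simpa using congrFun (congrFun hpow 1) 0
    exact hdiag ⟨(mul_eq_zero.1 h₀₁.symm).resolve_left hc,
      (mul_eq_zero.1 h₁₀.symm).resolve_left hc⟩
  refine ⟨z, ?_⟩
  rw [← hy']
  -- Columns of `P` are eigenvectors for `z` and `y`, read off from whichever row of `A` has a
  -- nonzero off-diagonal entry; then `det P` is that entry times `±(z - y)`.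
  by_cases h₀₁ : A 0 1 = 0
  · have h₁₀ : A 1 0 ≠ 0 := fun h₁₀ => hdiag ⟨h₀₁, h₁₀⟩
    refine ⟨!![z - A 1 1, y - A 1 1; A 1 0, A 1 0], left_ne_zero_of_mul_eq_one hzy, ?_, ?_⟩
    · rw [det_fin_two_of]
      intro h0
      refine mul_ne_zero h₁₀ (sub_ne_zero.2 hne) ?_
      linear_combination h0
    · have e₁ : A 0 0 = z + y - A 1 1 := by linear_combination -hsum
      rw [e₁] at hA
      ext i j
      fin_cases i <;> fin_cases j <;> simp [mul_apply, Fin.sum_univ_two, e₁]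
      · linear_combination hzy - hA
      · linear_combination hzy - hA
      · ring
      · ring
  · refine ⟨!![A 0 1, A 0 1; z - A 0 0, y - A 0 0], left_ne_zero_of_mul_eq_one hzy, ?_, ?_⟩
    · rw [det_fin_two_of]
      intro h0
      refine mul_ne_zero h₀₁ (sub_ne_zero.2 hne) ?_
      linear_combination -h0
    · have e₁ : A 1 1 = z + y - A 0 0 := by linear_combination -hsum
      rw [e₁] at hA
      ext i j
      fin_cases i <;> fin_cases j <;> simp [mul_apply, Fin.sum_univ_two, e₁]
      · ring
      · ring
      · linear_combination hzy - hA
      · linear_combination hzy - hA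

theorem pow_mul_eq_mul_diagonal_pow {A P : Matrix (Fin 2) (Fin 2) ℂ} {z : ℂ}
    (h : A * P = P * diagonal ![z, z⁻¹]) (k : ℕ) :
    A ^ k * P = P * diagonal ![z ^ k, (z ^ k)⁻¹] := by
  have h₁ : diagonal ![z ^ k, (z ^ k)⁻¹] = diagonal ![z, z⁻¹] ^ k := by
    rw [diagonal_pow]
    congr 1
    ext i
    fin_cases i <;> simp
  have h₂ : SemiconjBy P (diagonal ![z, z⁻¹]) A := h.symm
  rw [h₁]
  exact (h₂.pow_right k).eq.symm

/-- The condition `s⁻¹ = s` lets the two eigenvalues `z ^ k` and `z ^ (-k)` equal `s`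
simultaneously. It is applied with `s = 1` and `s = -1`. -/
theorem pow_eq_smul_one_iff {A P : Matrix (Fin 2) (Fin 2) ℂ} {z : ℂ} (hP : P.det ≠ 0)
    (h : A * P = P * diagonal ![z, z⁻¹]) (k : ℕ) {s : ℂ} (hs : s⁻¹ = s) :
    A ^ k = s • (1 : Matrix (Fin 2) (Fin 2) ℂ) ↔ z ^ k = s := by
  have hP' : IsUnit P := (isUnit_iff_isUnit_det P).2 hP.isUnit
  rw [← hP'.mul_left_inj, pow_mul_eq_mul_diagonal_pow h]
  have h₁ : s • (1 : Matrix (Fin 2) (Fin 2) ℂ) * P = P * s • (1 : Matrix (Fin 2) (Fin 2) ℂ) := by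
    simp
  rw [h₁, hP'.mul_right_inj]
  constructor
  · intro h₂
    simpa using congrFun (congrFun h₂ 0) 0
  · intro h₂
    ext i j
    fin_cases i <;> fin_cases j <;> simp [h₂, hs]

/-- An element of `SL(2, ℂ)` one of whose powers is `-1` has even order `2 * l`, and is
conjugate to the diagonal matrix with entries `z` and `z⁻¹`, for a primitive root of unity `z`. -/
theorem exists_primitiveRoot (A : SL(2, ℂ)) {a : ℕ} (ha : a ≠ 0)
    (h : (A : Matrix (Fin 2) (Fin 2) ℂ) ^ a = -1) :
    ∃ (l : ℕ) (z : ℂ) (P : Matrix (Fin 2) (Fin 2) ℂ), 0 < l ∧ l ∣ a ∧ orderOf A = 2 * l ∧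
      IsPrimitiveRoot z (2 * l) ∧ P.det ≠ 0 ∧
      (A : Matrix (Fin 2) (Fin 2) ℂ) * P = P * diagonal ![z, z⁻¹] := by
  obtain ⟨z, P, hz, hP, hAP⟩ := exists_diagonalization A.1 A.2 ha h
  have hza : z ^ a = -1 := by
    rw [← pow_eq_smul_one_iff hP hAP a (by norm_num), h]
    simp
  have horder : orderOf A = orderOf z := by
    rw [orderOf_eq_orderOf_iff]
    intro k
    rw [← pow_eq_smul_one_iff hP hAP k inv_one, one_smul]
    exact ⟨fun h => (Matrix.SpecialLinearGroup.coe_pow A k).symm.trans (congrArg _ h),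
      fun h => Subtype.ext ((Matrix.SpecialLinearGroup.coe_pow A k).trans h)⟩
  have hfin : z ^ (2 * a) = 1 := by rw [mul_comm, pow_mul, hza]; norm_num
  have hdvd : orderOf z ∣ 2 * a := orderOf_dvd_of_pow_eq_one hfin
  -- An odd order would give `1 = (z ^ a) ^ orderOf z = (-1) ^ orderOf z = -1`.
  have heven : Even (orderOf z) := by
    by_contra hodd
    rw [Nat.not_even_iff_odd] at hodd
    have h₁ : (z ^ a) ^ orderOf z = 1 := by rw [← pow_mul, mul_comm, pow_mul, pow_orderOf_eq_one,
      one_pow]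
    rw [hza, hodd.neg_one_pow] at h₁
    norm_num at h₁
  obtain ⟨l, hl⟩ := heven.two_dvd
  rw [hl] at hdvd
  have hla : l ∣ a := Nat.dvd_of_mul_dvd_mul_left two_pos hdvd
  exact ⟨l, z, P, Nat.pos_of_dvd_of_pos hla (Nat.pos_of_ne_zero ha), hla, horder.trans hl,
    hl ▸ IsPrimitiveRoot.orderOf z, hP, hAP⟩

end Diagonalization

/-! ### Determinants on binary forms -/

section Forms

open Module MvPolynomial

/-- The exponent of the monomial `X 0 ^ i * X 1 ^ (k - i)`. -/
noncomputable def formExponent (k : ℕ) (i : Fin (k + 1)) : Fin 2 →₀ ℕ :=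
  Finsupp.single 0 (i : ℕ) + Finsupp.single 1 (k - i)

theorem formExponent_injective (k : ℕ) : Function.Injective (formExponent k) := fun i j h => by
  simpa [formExponent, Fin.ext_iff] using DFunLike.congr_fun h 0

theorem range_formExponent (k : ℕ) : Set.range (formExponent k) = {d | d.degree = k} := by
  ext d
  rw [Set.mem_ofPred_eq, Finsupp.degree_eq_sum, Fin.sum_univ_two]
  constructor
  · rintro ⟨i, rfl⟩
    have := i.is_le
    simp [formExponent]
    omega
  · intro h
    refine ⟨⟨d 0, by omega⟩, Finsupp.ext fun x => ?_⟩
    fin_cases x <;> simp [formExponent]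
    omega

theorem linearIndependent_monomial (k : ℕ) : LinearIndependent ℂ
    fun i => (monomial (formExponent k i) 1 : MvPolynomial (Fin 2) ℂ) := by
  have := (basisMonomials (Fin 2) ℂ).linearIndependent.comp _ (formExponent_injective k)
  simpa [Function.comp_def] using this

theorem span_monomial (k : ℕ) : Submodule.span ℂ
    (Set.range fun i => (monomial (formExponent k i) 1 : MvPolynomial (Fin 2) ℂ)) =
      homogeneousSubmodule (Fin 2) ℂ k := by
  rw [homogeneousSubmodule_eq_finsupp_supported, AddMonoidAlgebra.supported_eq_span_single,
    ← range_formExponent, ← Set.range_comp]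
  rfl

/-- The basis of the binary forms of degree `k` that consists of the monomials. -/
noncomputable def formBasis (k : ℕ) : Basis (Fin (k + 1)) ℂ (BinaryForms (k + 1)) :=
  (Basis.span (linearIndependent_monomial k)).map (LinearEquiv.ofEq _ _ (span_monomial k))

theorem coe_formBasis (k : ℕ) (i : Fin (k + 1)) :
    (formBasis k i : MvPolynomial (Fin 2) ℂ) = monomial (formExponent k i) 1 := by
  rw [formBasis, Basis.map_apply, LinearEquiv.coe_ofEq_apply, Basis.span_apply]

/-- The substitution `p(z) ↦ p(A z)` on binary forms. -/
noncomputable def formSubstitute (n : ℕ) (A : Matrix (Fin 2) (Fin 2) ℂ) :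
    Module.End ℂ (BinaryForms n) :=
  (substitute A).toLinearMap.restrict (substitute_mem A (n - 1))

theorem formSubstitute_mul (n : ℕ) (A B : Matrix (Fin 2) (Fin 2) ℂ) :
    formSubstitute n (A * B) = formSubstitute n B * formSubstitute n A :=
  LinearMap.ext fun p => Subtype.ext (substitute_mul A B p.1)

theorem formSubstitute_one (n : ℕ) : formSubstitute n 1 = 1 :=
  LinearMap.ext fun p => Subtype.ext (substitute_one p.1)

/-- The inverse in the definition of `σ_n` cancels the inverse in the right action, so a core block
becomes the substitution by `ρ(ℓ)` itself, minus the identity. -/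
theorem symRep_inv (n : ℕ) (A : SL(2, ℂ)) : symRep n A⁻¹ = formSubstitute n A.1 := by
  refine LinearMap.ext fun p => Subtype.ext ?_
  change substitute ((A⁻¹)⁻¹).1 p.1 = substitute A.1 p.1
  rw [inv_inv]

theorem formSubstitute_diagonal_formBasis (k : ℕ) (z w : ℂ) (i : Fin (k + 1)) :
    formSubstitute (k + 1) (Matrix.diagonal ![z, w]) (formBasis k i) =
      (z ^ (i : ℕ) * w ^ (k - i : ℕ)) • formBasis k i := by
  apply Subtype.ext
  change substitute _ (formBasis k i).1 = (z ^ (i : ℕ) * w ^ (k - i : ℕ)) • (formBasis k i).1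
  rw [coe_formBasis, monomial_eq, map_mul, substitute_C, Finsupp.prod_fintype _ _ (by simp),
    map_prod, Fin.prod_univ_two, Fin.prod_univ_two]
  simp only [map_pow, substitute_X, Fin.sum_univ_two]
  simp [formExponent, mul_pow, smul_eq_C_mul]
  ring

theorem det_formSubstitute_diagonal_sub_one (k : ℕ) (z w : ℂ) :
    LinearMap.det (formSubstitute (k + 1) (Matrix.diagonal ![z, w]) - 1) =
      ∏ i ∈ Finset.range (k + 1), (z ^ i * w ^ (k - i) - 1) := by
  have h : LinearMap.toMatrix (formBasis k) (formBasis k)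
      (formSubstitute (k + 1) (Matrix.diagonal ![z, w]) - 1) =
        Matrix.diagonal fun i : Fin (k + 1) => z ^ (i : ℕ) * w ^ (k - i : ℕ) - 1 := by
    ext i j
    rw [LinearMap.toMatrix_apply, LinearMap.sub_apply, formSubstitute_diagonal_formBasis,
      Module.End.one_apply, map_sub, map_smul, Basis.repr_self, Matrix.diagonal_apply]
    by_cases hij : i = j
    · simp [hij]
    · simp [hij]
  rw [← LinearMap.det_toMatrix (formBasis k), h, Matrix.det_diagonal, Finset.prod_range]

theorem det_sub_one_eq_of_mul_eq_mul {K V : Type*} [Field K] [AddCommGroup V] [Module K V]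
    {f g p : Module.End K V} (hp : LinearMap.det p ≠ 0) (h : p * f = g * p) :
    LinearMap.det (f - 1) = LinearMap.det (g - 1) := by
  have h₁ : p * (f - 1) = (g - 1) * p := by rw [mul_sub, sub_mul, h, mul_one, one_mul]
  have h₂ := congrArg LinearMap.det h₁
  rw [map_mul, map_mul, mul_comm] at h₂
  exact mul_right_cancel₀ hp h₂

theorem det_formSubstitute_sub_one_eq {n : ℕ} {A D P : Matrix (Fin 2) (Fin 2) ℂ} (hP : P.det ≠ 0)
    (h : A * P = P * D) : LinearMap.det (formSubstitute n A - 1) =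
      LinearMap.det (formSubstitute n D - 1) := by
  have hinv : formSubstitute n P * formSubstitute n P⁻¹ = 1 := by
    rw [← formSubstitute_mul, Matrix.nonsing_inv_mul P hP.isUnit, formSubstitute_one]
  have hne : LinearMap.det (formSubstitute n P) ≠ 0 := by
    intro h0
    have := congrArg LinearMap.det hinv
    rw [map_mul, h0, zero_mul, map_one] at this
    exact zero_ne_one this
  refine det_sub_one_eq_of_mul_eq_mul hne ?_
  rw [← formSubstitute_mul, h, formSubstitute_mul]

theorem finrank_binaryForms {n : ℕ} (hn : n ≠ 0) : finrank ℂ (BinaryForms n) = n := by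
  obtain ⟨k, rfl⟩ := Nat.exists_eq_succ_of_ne_zero hn
  rw [finrank_eq_card_basis (formBasis k), Fintype.card_fin]

theorem finiteDimensional_binaryForms {n : ℕ} (hn : n ≠ 0) :
    FiniteDimensional ℂ (BinaryForms n) := by
  obtain ⟨k, rfl⟩ := Nat.exists_eq_succ_of_ne_zero hn
  exact (formBasis k).finiteDimensional_of_finite

/-- The eigenvalues `z ^ i * z⁻¹ ^ (2N - 1 - i)` are the powers of `z` with odd exponent from `-(2N
- 1)` to `2N - 1`. On the unit circle opposite exponents give factors of equal modulus, whence the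
square; the lower half of the product is reversed to match the upper one. -/
theorem norm_det_formSubstitute_sub_one {A P : Matrix (Fin 2) (Fin 2) ℂ} {z : ℂ}
    (hP : P.det ≠ 0) (h : A * P = P * Matrix.diagonal ![z, z⁻¹]) (hz : ‖z‖ = 1) {N : ℕ}
    (hN : N ≠ 0) : ‖LinearMap.det (formSubstitute (2 * N) A - 1)‖ =
      (∏ i ∈ Finset.range N, ‖z ^ (2 * i + 1) - 1‖) ^ 2 := by
  have hz0 : z ≠ 0 := norm_ne_zero_iff.1 (by simp [hz])
  obtain ⟨k, hk⟩ := Nat.exists_eq_succ_of_ne_zero (mul_ne_zero two_ne_zero hN)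
  rw [det_formSubstitute_sub_one_eq hP h, hk, Nat.succ_eq_add_one,
    det_formSubstitute_diagonal_sub_one, norm_prod, ← Nat.succ_eq_add_one, ← hk, two_mul,
    Finset.prod_range_add, ← Finset.prod_range_reflect, sq]
  congr 1
  · refine Finset.prod_congr rfl fun i hi => ?_
    have hi := Finset.mem_range.1 hi
    have h₁ : z ^ (N - 1 - i) * z⁻¹ ^ (k - (N - 1 - i)) = (z ^ (2 * i + 1))⁻¹ := by
      rw [show k - (N - 1 - i) = (N - 1 - i) + (2 * i + 1) by omega, pow_add, ← mul_assoc,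
        ← mul_pow, mul_inv_cancel₀ hz0, one_pow, one_mul, inv_pow]
    have h₂ : (z ^ (2 * i + 1))⁻¹ - 1 = -((z ^ (2 * i + 1) - 1) * (z ^ (2 * i + 1))⁻¹) := by
      field_simp
      ring
    rw [h₁, h₂, norm_neg, norm_mul, norm_inv, norm_pow, hz]
    simp
  · refine Finset.prod_congr rfl fun i hi => ?_
    have hi := Finset.mem_range.1 hi
    have h₁ : z ^ (N + i) * z⁻¹ ^ (k - (N + i)) = z ^ (2 * i + 1) := by
      rw [show N + i = (k - (N + i)) + (2 * i + 1) by omega, pow_add,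
        show k - (k - (N + i) + (2 * i + 1)) = k - (N + i) by omega, mul_right_comm,
        ← mul_pow, mul_inv_cancel₀ hz0, one_pow, one_mul]
    rw [h₁]

end Forms

/-! ### Asymptotics -/

section Asymptotics

open Filter

/-- The averages of a periodic sequence converge to the average over a period. -/
theorem tendsto_sum_div_of_periodic {u : ℕ → ℝ} {l : ℕ} (hl : 0 < l) (hu : Function.Periodic u l) :
    Tendsto (fun N : ℕ => (∑ i ∈ Finset.range N, u i) / N) atTop
      (nhds ((∑ i ∈ Finset.range l, u i) / l)) := by
  set s := ∑ i ∈ Finset.range l, u i with hs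
  -- The deviation of the partial sums from linear growth is itself periodic, hence bounded, and
  -- vanishes after division by `N`.
  let v (N : ℕ) : ℝ := ∑ i ∈ Finset.range N, u i - N * (s / l)
  have hl' : (l : ℝ) ≠ 0 := by exact_mod_cast hl.ne'
  have hv : Function.Periodic v l := by
    intro N
    induction N with
    | zero =>
      simp only [v, zero_add, ← hs, Finset.range_zero, Finset.sum_empty, Nat.cast_zero, zero_mul,
        sub_zero]
      field_simp
      ring
    | succ N ih =>
      have h₁ : v (N + 1 + l) = v (N + l) + (u (N + l) - s / l) := by
        simp only [v, show N + 1 + l = N + l + 1 by omega, Finset.sum_range_succ]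
        push_cast
        ring
      have h₂ : v (N + 1) = v N + (u N - s / l) := by
        simp only [v, Finset.sum_range_succ]
        push_cast
        ring
      rw [h₁, h₂, ih, hu]
  have hbdd (N : ℕ) : |v N| ≤ ∑ i ∈ Finset.range l, |v i| := by
    rw [← hv.map_mod_nat N]
    exact Finset.single_le_sum (f := fun i => |v i|) (fun i _ => abs_nonneg _)
      (Finset.mem_range.2 (Nat.mod_lt N hl))
  have hlim : Tendsto (fun N : ℕ => v N / N) atTop (nhds 0) :=
    tendsto_bdd_div_atTop_nhds_zero (b := -∑ i ∈ Finset.range l, |v i|)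
      (B := ∑ i ∈ Finset.range l, |v i|)
      (Eventually.of_forall fun N => (abs_le.1 (hbdd N)).1)
      (Eventually.of_forall fun N => (abs_le.1 (hbdd N)).2) tendsto_natCast_atTop_atTop
  have := hlim.add_const (s / l)
  rw [zero_add] at this
  refine this.congr' ?_
  filter_upwards [eventually_ne_atTop 0] with N hN
  have : (N : ℝ) ≠ 0 := by exact_mod_cast hN
  simp only [v]
  field_simp
  ring

/-- An odd exponent is not a multiple of the even order of `z`. This is what makes the core blocks
invertible. -/
theorem pow_odd_ne_one {z : ℂ} {l : ℕ} (hz : IsPrimitiveRoot z (2 * l)) (i : ℕ) :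
    z ^ (2 * i + 1) ≠ 1 := fun h => by
  have := (Nat.dvd_mul_right 2 l).trans (hz.dvd_of_pow_eq_one _ h)
  omega

/-- The odd powers of `z` are the roots of `X ^ l + 1`, because `z ^ l = -1`; the product is its
value at `1`. -/
theorem prod_one_sub_pow_odd {z : ℂ} {l : ℕ} (hl : 0 < l) (hz : IsPrimitiveRoot z (2 * l)) :
    ∏ i ∈ Finset.range l, (1 - z ^ (2 * i + 1)) = 2 := by
  have hz2 : IsPrimitiveRoot (z ^ 2) l := hz.pow (by omega) rfl
  have hzl : z ^ l = -1 := by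
    have h₁ : z ^ l * z ^ l = 1 := by rw [← pow_add, ← two_mul, hz.pow_eq_one]
    refine (mul_self_eq_one_iff.1 h₁).resolve_left fun h => ?_
    have := Nat.le_of_dvd hl (hz.dvd_of_pow_eq_one _ h)
    omega
  -- This factors `1 - z ^ l` over the `l`-th roots of unity `ζ` with factors `1 - ζ z`; the `ζ` are
  -- the powers of `z ^ 2`.
  have h := hz2.pow_sub_pow_eq_prod_sub_mul 1 z hl
  rw [hzl, one_pow, sub_neg_eq_add, one_add_one_eq_two] at h
  rw [h]
  refine Finset.prod_bij (fun i _ => (z ^ 2) ^ i) (fun i _ => ?_) (fun i hi j hj hij => ?_)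
    (fun y hy => ?_) (fun i _ => ?_)
  · rw [Polynomial.mem_nthRootsFinset hl, ← pow_mul, mul_comm, pow_mul, hz2.pow_eq_one, one_pow]
  · exact hz2.pow_inj (Finset.mem_range.1 hi) (Finset.mem_range.1 hj) hij
  · rw [Polynomial.mem_nthRootsFinset hl] at hy
    have : NeZero l := ⟨hl.ne'⟩
    obtain ⟨i, hi, rfl⟩ := hz2.eq_pow_of_pow_eq_one hy
    exact ⟨i, Finset.mem_range.2 hi, rfl⟩
  · rw [pow_succ, pow_mul]

theorem tendsto_log_prod_pow_odd {z : ℂ} {l : ℕ} (hl : 0 < l) (hz : IsPrimitiveRoot z (2 * l)) :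
    Tendsto (fun N : ℕ => Real.log (∏ i ∈ Finset.range N, ‖z ^ (2 * i + 1) - 1‖) / N) atTop
      (nhds (Real.log 2 / l)) := by
  have hne (i : ℕ) : ‖z ^ (2 * i + 1) - 1‖ ≠ 0 :=
    norm_ne_zero_iff.2 (sub_ne_zero.2 (pow_odd_ne_one hz i))
  have hper : Function.Periodic (fun i : ℕ => Real.log ‖z ^ (2 * i + 1) - 1‖) l := fun i => by
    simp only
    rw [show 2 * (i + l) + 1 = 2 * i + 1 + 2 * l by ring, pow_add, hz.pow_eq_one, mul_one]
  have h := tendsto_sum_div_of_periodic hl hper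
  simp only [← Real.log_prod (fun i _ => hne i)] at h
  have h2 : ∏ i ∈ Finset.range l, ‖z ^ (2 * i + 1) - 1‖ = 2 := by
    simp only [norm_sub_rev (z ^ _) 1, ← norm_prod, prod_one_sub_pow_odd hl hz]
    simp
  rwa [h2] at h

end Asymptotics

/-! ### The torsion of the representations `ρ_{2N}` -/

section Main

open Filter Module

/-- Forms in `V_{2N}` have odd degree `2N - 1`, so `-I` changes their sign. This is where even
dimension is used. -/
theorem symRep_eq_neg_one {N : ℕ} (hN : N ≠ 0) {A : SL(2, ℂ)}
    (hA : (A : Matrix (Fin 2) (Fin 2) ℂ) = -1) : symRep (2 * N) A = -1 := by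
  have hinv : A⁻¹ = A := by
    refine inv_eq_of_mul_eq_one_right (Subtype.ext ?_)
    refine (Matrix.SpecialLinearGroup.coe_mul A A).trans ?_
    rw [hA]
    simp
  have hdiag : (-1 : Matrix (Fin 2) (Fin 2) ℂ) = Matrix.diagonal ![-1, -1] := by
    ext i j
    fin_cases i <;> fin_cases j <;> simp
  obtain ⟨k, hk⟩ := Nat.exists_eq_succ_of_ne_zero (mul_ne_zero two_ne_zero hN)
  rw [← hinv, symRep_inv, hA, hdiag, hk]
  refine (formBasis k).ext fun i => ?_
  have hodd : Odd k := ⟨N - 1, by omega⟩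
  rw [formSubstitute_diagonal_formBasis, ← pow_add, Nat.add_sub_cancel' i.is_le,
    hodd.neg_one_pow]
  exact neg_one_smul ℂ (formBasis k i)

variable {S : SeifertIndex} {T : S.Framing}
  {ρ : PiOne (Space S T) (Space.base S T) →* SL(2, ℂ)}
  (hρ : (ρ (Space.fiberClass S T) : Matrix (Fin 2) (Fin 2) ℂ) = -1)
include hρ

theorem coreClass_pow_eq_neg_one (j : Fin (S.m + 1)) {a : ℕ} (ha : S.slopeα j = a) :
    (ρ (Space.coreClass S T j) : Matrix (Fin 2) (Fin 2) ℂ) ^ a = -1 := by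
  have h := congrArg ρ (Space.fiberClass_mul_coreClass S T j)
  rw [ha, zpow_natCast, map_mul, map_pow, map_one] at h
  have h' : (ρ (Space.fiberClass S T) : Matrix (Fin 2) (Fin 2) ℂ) *
      (ρ (Space.coreClass S T j) : Matrix (Fin 2) (Fin 2) ℂ) ^ a = 1 := congrArg Subtype.val h
  rw [hρ, neg_one_mul] at h'
  rw [← h', neg_neg]

/-- The cores act with even order, and diagonally in a suitable basis. -/
theorem exists_core_data : ∃ (l : Fin (S.m + 1) → ℕ) (z : Fin (S.m + 1) → ℂ)
    (P : Fin (S.m + 1) → Matrix (Fin 2) (Fin 2) ℂ), l 0 = 1 ∧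
    (∀ j, 0 < l j) ∧ (∀ j, orderOf (ρ (Space.coreClass S T j)) = 2 * l j) ∧
    (∀ j, IsPrimitiveRoot (z j) (2 * l j)) ∧ (∀ j, (P j).det ≠ 0) ∧
    ∀ j, (ρ (Space.coreClass S T j) : Matrix (Fin 2) (Fin 2) ℂ) * P j =
      P j * Matrix.diagonal ![z j, (z j)⁻¹] := by
  have h (j : Fin (S.m + 1)) : ∃ (l : ℕ) (z : ℂ) (P : Matrix (Fin 2) (Fin 2) ℂ),
      (j = 0 → l = 1) ∧ 0 < l ∧ orderOf (ρ (Space.coreClass S T j)) = 2 * l ∧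
      IsPrimitiveRoot z (2 * l) ∧ P.det ≠ 0 ∧
      (ρ (Space.coreClass S T j) : Matrix (Fin 2) (Fin 2) ℂ) * P =
        P * Matrix.diagonal ![z, z⁻¹] := by
    -- The filling with index 0 has slope coefficient 1, and `l` divides it; hence `l 0 = 1`.
    obtain ⟨a, ha0, ha, ha1⟩ : ∃ a : ℕ, a ≠ 0 ∧ S.slopeα j = a ∧ (j = 0 → a = 1) := by
      induction j using Fin.cases with
      | zero => exact ⟨1, one_ne_zero, by simp [SeifertIndex.slopeα], fun _ => rfl⟩
      | succ j =>
        have := S.two_le j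
        exact ⟨S.α j, by omega, rfl, fun h => absurd h (Fin.succ_ne_zero j)⟩
    obtain ⟨l, z, P, hl, hla, h⟩ :=
      exists_primitiveRoot (ρ (Space.coreClass S T j)) ha0 (coreClass_pow_eq_neg_one hρ j ha)
    exact ⟨l, z, P, fun hj => Nat.dvd_one.1 (ha1 hj ▸ hla), hl, h⟩
  choose l z P h using h
  exact ⟨l, z, P, (h 0).1 rfl, fun j => (h j).2.1, fun j => (h j).2.2.1, fun j => (h j).2.2.2.1,
    fun j => (h j).2.2.2.2.1, fun j => (h j).2.2.2.2.2⟩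

theorem isTorsion_coverComplex {l : Fin (S.m + 1) → ℕ} {z : Fin (S.m + 1) → ℂ}
    {P : Fin (S.m + 1) → Matrix (Fin 2) (Fin 2) ℂ} (hl : ∀ j, 0 < l j)
    (hz : ∀ j, IsPrimitiveRoot (z j) (2 * l j)) (hP : ∀ j, (P j).det ≠ 0)
    (hdiag : ∀ j, (ρ (Space.coreClass S T j) : Matrix (Fin 2) (Fin 2) ℂ) * P j =
      P j * Matrix.diagonal ![z j, (z j)⁻¹]) {N : ℕ} (hN : N ≠ 0)
    (B : Basis (Fin (finrank ℂ (BinaryForms (2 * N)))) ℂ (BinaryForms (2 * N))) :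
    ∃ τ : ℂ, IsTorsion ((Space.coverComplex S T).TwistedChain (BinaryForms (2 * N)))
      ((Space.coverComplex S T).twistedBoundary (inducedRep ρ (2 * N)))
      (fun i => Pi.basis fun _ : (Space.coverComplex S T).cell i => B)
      (Space.coverComplex S T).dim τ ∧
      ‖τ‖ = (2 ^ (2 * N)) ^ (2 * S.g + S.m) /
        (2 ^ (2 * N) * ∏ j, (∏ i ∈ Finset.range N, ‖z j ^ (2 * i + 1) - 1‖) ^ 2) := by
  have hnorm (j : Fin (S.m + 1)) : ‖LinearMap.det (inducedRep ρ (2 * N)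
      (Space.edgeClass S T (Cell1.core j))⁻¹ - 1)‖ =
        (∏ i ∈ Finset.range N, ‖z j ^ (2 * i + 1) - 1‖) ^ 2 := by
    have h₁ : inducedRep ρ (2 * N) (Space.edgeClass S T (Cell1.core j))⁻¹ =
        formSubstitute (2 * N) (ρ (Space.coreClass S T j)).1 := by
      rw [← symRep_inv, ← map_inv]
      rfl
    rw [h₁]
    exact norm_det_formSubstitute_sub_one (hP j) (hdiag j)
      (Complex.norm_eq_one_of_pow_eq_one (hz j).pow_eq_one (by have := hl j; omega)) hN
  have := finiteDimensional_binaryForms (mul_ne_zero two_ne_zero hN)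
  have h := isTorsion_cellComplex (hol := Space.edgeClass S T) (ρ := inducedRep ρ (2 * N))
    (fun _ => rfl) (symRep_eq_neg_one hN hρ) (Space.fiberClass_mul_coreClass S T)
    (Space.pathHol_boundaryEdgePath S T) (fun j => norm_ne_zero_iff.1 ?_) B
  · simp only [hnorm, finrank_binaryForms (mul_ne_zero two_ne_zero hN)] at h
    exact h
  · rw [hnorm]
    exact pow_ne_zero 2 (Finset.prod_ne_zero_iff.2 fun i _ =>
      norm_ne_zero_iff.2 (sub_ne_zero.2 (pow_odd_ne_one (hz j) i)))

end Main

end SeifertTorsion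

/-! ### The limits of the torsion. -/

open SeifertTorsion

theorem theorem4p5 (S : SeifertTorsion.SeifertIndex) (T : S.Framing)
    (ρ : SeifertTorsion.PiOne (SeifertTorsion.Space S T) (SeifertTorsion.Space.base S T) →*
      Matrix.SpecialLinearGroup (Fin 2) ℂ)
    (hρ : (ρ (SeifertTorsion.Space.fiberClass S T) : Matrix (Fin 2) (Fin 2) ℂ) = -1) :
    (∀ N : ℕ, 1 ≤ N →
      (SeifertTorsion.Space.coverComplex S T).IsAcyclicRep
        (SeifertTorsion.inducedRep ρ (2 * N)) ∧
      ∃ τ : ℂ, (SeifertTorsion.Space.coverComplex S T).IsReidemeisterTorsion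
        (SeifertTorsion.inducedRep ρ (2 * N)) τ) ∧
    ∃ lam : Fin S.m → ℕ,
      (∀ j, 0 < lam j ∧
        orderOf (ρ (SeifertTorsion.Space.coreClass S T j.succ)) = 2 * lam j) ∧
      ∀ Tor : ℕ → ℂ,
        (∀ N : ℕ, 1 ≤ N → (SeifertTorsion.Space.coverComplex S T).IsReidemeisterTorsion
          (SeifertTorsion.inducedRep ρ (2 * N)) (Tor N)) →
        Filter.Tendsto (fun N : ℕ => Real.log ‖Tor N‖ / (2 * (N : ℝ)) ^ 2)
          Filter.atTop (nhds 0) ∧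
        Filter.Tendsto (fun N : ℕ => Real.log ‖Tor N‖ / (2 * (N : ℝ))) Filter.atTop
          (nhds (-(2 - 2 * (S.g : ℝ) - ∑ j, ((lam j : ℝ) - 1) / (lam j : ℝ)) * Real.log 2)) ∧
        ((∀ j, lam j = S.α j) →
          Filter.Tendsto (fun N : ℕ => Real.log ‖Tor N‖ / (2 * (N : ℝ))) Filter.atTop
            (nhds (-(2 - 2 * (S.g : ℝ) - ∑ j, ((S.α j : ℝ) - 1) / (S.α j : ℝ)) * Real.log 2)) ∧
          -(2 - 2 * (S.g : ℝ) - ∑ j, ((S.α j : ℝ) - 1) / (S.α j : ℝ)) * Real.log 2 =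
            -S.orbifoldEulerChar * Real.log 2) := by
  obtain ⟨l, z, P, hl0, hl, horder, hz, hP, hdiag⟩ := exists_core_data hρ
  have htor {N : ℕ} (hN : N ≠ 0) := isTorsion_coverComplex hρ hl hz hP hdiag hN
  refine ⟨fun N hN => ?_, fun j => l j.succ, fun j => ⟨hl _, horder _⟩, fun Tor hTor => ?_⟩
  · have hN : N ≠ 0 := by omega
    have := finiteDimensional_binaryForms (mul_ne_zero two_ne_zero hN)
    obtain ⟨τ, hτ, -⟩ := htor hN (Module.finBasis ℂ _)
    exact ⟨hτ.1, τ, _, hτ⟩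
  let F (j : Fin (S.m + 1)) (N : ℕ) : ℝ := ∏ i ∈ Finset.range N, ‖z j ^ (2 * i + 1) - 1‖
  have hF (j : Fin (S.m + 1)) (N : ℕ) : F j N ≠ 0 := Finset.prod_ne_zero_iff.2 fun i _ =>
    norm_ne_zero_iff.2 (sub_ne_zero.2 (pow_odd_ne_one (hz j) i))
  have hnorm (N : ℕ) (hN : N ≠ 0) : ‖Tor N‖ =
      (2 ^ (2 * N)) ^ (2 * S.g + S.m) / (2 ^ (2 * N) * ∏ j, F j N ^ 2) := by
    obtain ⟨B, hB⟩ := hTor N (by omega)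
    -- The explicit value is taken in the same basis `B` as the given one, so that the two can
    -- differ only by a sign.
    obtain ⟨τ, hτ, hτnorm⟩ := htor hN B
    have hsub : Subsingleton ((Space.coverComplex S T).TwistedChain (BinaryForms (2 * N))
        ((Space.coverComplex S T).dim + 1)) :=
      inferInstanceAs (Subsingleton (Empty → BinaryForms (2 * N)))
    rw [← hτnorm]
    have hsq := congrArg norm (hτ.sq_eq hsub hB)
    rw [norm_pow, norm_pow] at hsq
    exact (pow_left_inj₀ (norm_nonneg _) (norm_nonneg _) two_ne_zero).1 hsq
  have hlog (N : ℕ) (hN : N ≠ 0) : Real.log ‖Tor N‖ / (2 * (N : ℝ)) =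
      (2 * S.g + S.m - 1) * Real.log 2 - ∑ j, Real.log (F j N) / N := by
    have hN' : (N : ℝ) ≠ 0 := by exact_mod_cast hN
    have hprod : ∏ j, F j N ^ 2 ≠ 0 := Finset.prod_ne_zero_iff.2 fun j _ => pow_ne_zero 2 (hF j N)
    rw [hnorm N hN, Real.log_div (by positivity) (mul_ne_zero (by positivity) hprod),
      Real.log_mul (by positivity) hprod, Real.log_prod fun j _ => pow_ne_zero 2 (hF j N)]
    simp only [Real.log_pow, ← Finset.mul_sum, ← Finset.sum_div]
    push_cast
    field_simp
    ring
  have hlim₀ : Filter.Tendsto (fun N : ℕ => Real.log ‖Tor N‖ / (2 * (N : ℝ))) Filter.atTop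
      (nhds ((2 * S.g + S.m - 1) * Real.log 2 - ∑ j, Real.log 2 / l j)) := by
    refine Filter.Tendsto.congr' (f₁ := fun N : ℕ =>
      (2 * S.g + S.m - 1) * Real.log 2 - ∑ j, Real.log (F j N) / N) ?_ ?_
    · filter_upwards [Filter.eventually_ne_atTop 0] with N hN
      exact (hlog N hN).symm
    · exact tendsto_const_nhds.sub
        (tendsto_finsetSum _ fun j _ => tendsto_log_prod_pow_odd (hl j) (hz j))
  -- The term `j = 0` equals `log 2`, since `l 0 = 1`; it lowers `2g + m - 1` to `2g + m - 2`, and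
  -- the `m` is absorbed through `(l - 1) / l = 1 - 1 / l`.
  have hvalue : (2 * S.g + S.m - 1) * Real.log 2 - ∑ j, Real.log 2 / l j =
      -(2 - 2 * (S.g : ℝ) - ∑ j : Fin S.m, ((l j.succ : ℝ) - 1) / (l j.succ : ℝ)) *
        Real.log 2 := by
    have h₁ (j : Fin S.m) : ((l j.succ : ℝ) - 1) / (l j.succ : ℝ) = 1 - 1 / l j.succ := by
      have : (l j.succ : ℝ) ≠ 0 := by exact_mod_cast (hl j.succ).ne'
      field_simp
    have h₂ : ∑ j : Fin S.m, Real.log 2 / l j.succ =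
        Real.log 2 * ∑ j : Fin S.m, 1 / (l j.succ : ℝ) := by
      rw [Finset.mul_sum]
      exact Finset.sum_congr rfl fun j _ => by ring
    rw [Fin.sum_univ_succ, hl0, h₂]
    simp only [h₁, Finset.sum_sub_distrib, Finset.sum_const, Finset.card_univ, Fintype.card_fin,
      nsmul_eq_mul, mul_one, Nat.cast_one, div_one]
    ring
  have hlim : Filter.Tendsto (fun N : ℕ => Real.log ‖Tor N‖ / (2 * (N : ℝ))) Filter.atTop
      (nhds (-(2 - 2 * (S.g : ℝ) - ∑ j : Fin S.m, ((l j.succ : ℝ) - 1) / (l j.succ : ℝ)) *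
        Real.log 2)) := hvalue ▸ hlim₀
  refine ⟨?_, hlim, fun hα => ⟨?_, ?_⟩⟩
  -- The quotient by `2N` converges, so a further division by `2N` sends it to zero.
  · have hinf : Filter.Tendsto (fun N : ℕ => 2 * (N : ℝ)) Filter.atTop Filter.atTop :=
      tendsto_natCast_atTop_atTop.const_mul_atTop two_pos
    refine (hlim.div_atTop hinf).congr fun N => ?_
    rw [div_div, sq]
  · simpa only [hα] using hlim
  · rw [SeifertIndex.orbifoldEulerChar]
    have h₁ (j : Fin S.m) : ((S.α j : ℝ) - 1) / (S.α j : ℝ) = 1 - 1 / (S.α j : ℝ) := by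
      have : (S.α j : ℝ) ≠ 0 := by have := S.two_le j; exact_mod_cast (by omega : S.α j ≠ 0)
      field_simp
    simp only [h₁]
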